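/- Let $\eta:\mathbb{R}^n\to\mathbb{R}$ be smooth, nonnegative, symmetric ($\eta(-x)=\eta(x)$), supported in the closed unit ball, with $\int\eta=1$. For $\epsilon>0$ put $\eta_\epsilon(x)=\epsilon^{-n}\eta(\epsilon^{-1}x)$, and for a function or distribution $u$ on $\mathbb{R}^n$ put $(u)_\epsilon=u_\epsilon=\eta_\epsilon\star u$, that is, $(u)_\epsilon(x)=\langle u,\eta_\epsilon(x-\cdot)\rangle$. For $f:\mathbb{R}^n\to\mathbb{R}$ and a vector field $\sigma:\mathbb{R}^n\to\mathbb{R}^n$ define (with summation over repeated indices) $$T_{\sigma,\epsilon}(f)=\sigma\cdot\nabla f_\epsilon-(\operatorname{div}(\sigma f))_\epsilon,$$ $$S_{\sigma,\epsilon}(f)=\tfrac12\sigma_i\sigma_j\partial_i\partial_j f_\epsilon-\sigma\cdot\nabla(\operatorname{div}(\sigma f))_\epsilon+\big(\tfrac12\partial_i\partial_j(\sigma_i\sigma_j f)\big)_\epsilon,$$ where $\operatorname{div}(\sigma f)$ and $\partial_i\partial_j(\sigma_i\sigma_jf)$ are taken in the sense of distributions. Let $p,q,r\in[1,\infty]$,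 $f\in L^p_{\mathrm{loc}}(\mathbb{R}^n)$ and $\sigma\in W^{1,q}_{\mathrm{loc}}(\mathbb{R}^n;\mathbb{R}^n)$. (i) If $\frac1r=\frac1q+\frac1p$ and $r<\infty$, then as $\epsilon\to0^+$ $$T_{\sigma,\epsilon}(f)\to-(\operatorname{div}\sigma)f\quad\text{in }L^r_{\mathrm{loc}}(\mathbb{R}^n).$$ (ii) If $\frac1r=\frac2q+\frac1p$ and $r<\infty$, then as $\epsilon\to0^+$ $$S_{\sigma,\epsilon}(f)\to\tfrac12\big(\partial_i\sigma_j\,\partial_j\sigma_i+(\operatorname{div}\sigma)^2\big)f\quad\text{in }L^r_{\mathrm{loc}}(\mathbb{R}^n).$$ (iii) There is a finite constant $C$, depending only on $\eta$ (and so on $n$), such that for all such $p,q,r,f,\sigma$ (with $r=\infty$ allowed), every compact $K\subseteq\mathbb{R}^n$ and every $\epsilon>0$, with $K_\epsilon=\{x:\operatorname{dist}(x,K)\le\epsilon\}$ (and $K_\epsilon=\emptyset$ if $K=\emptyset$), the functions below belong to $L^r(K)$ and $$\|T_{\sigma,\epsilon}(f)\|_{L^r(K)}\le C\,\|\nabla\sigma\|_{L^q(K_\epsilon)}\|f\|_{L^p(K_\epsilon)}\quad\text{if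 }\tfrac1r=\tfrac1q+\tfrac1p,$$ $$\|S_{\sigma,\epsilon}(f)\|_{L^r(K)}\le C\,\|\nabla\sigma\|_{L^q(K_\epsilon)}^2\|f\|_{L^p(K_\epsilon)}\quad\text{if }\tfrac1r=\tfrac2q+\tfrac1p.$$ Here $|\nabla\sigma|$ is the Euclidean (Frobenius) norm of the matrix $(\partial_i\sigma_j)$. -/

import Mathlib

open MeasureTheory Filter Topology
open scoped ENNReal NNReal ContDiff

namespace Commutator

/-- The Euclidean space `ℝⁿ`. -/
abbrev E (n : ℕ) : Type := EuclideanSpace ℝ (Fin n)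

/-- The classical partial derivative `∂ᵢ u`. -/
noncomputable def partialDeriv {n : ℕ} (i : Fin n) (u : E n → ℝ) (x : E n) : ℝ :=
  fderiv ℝ u x (EuclideanSpace.single i 1)

/-- `f ∈ L^p_loc(ℝⁿ)`: `f` is in `L^p(K)` for every compact set `K`. -/
def MemLpLoc {n : ℕ} {F : Type*} [NormedAddCommGroup F] (f : E n → F) (p : ℝ≥0∞) : Prop :=
  ∀ K : Set (E n), IsCompact K → MemLp f p (volume.restrict K)

/-- `g` is the weak partial derivative `∂ᵢ u` on `ℝⁿ`. -/
def HasWeakPartialDeriv {n : ℕ} (i : Fin n) (u g : E n → ℝ) : Prop :=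
  LocallyIntegrable u volume ∧ LocallyIntegrable g volume ∧
    ∀ φ : E n → ℝ, ContDiff ℝ ∞ φ → HasCompactSupport φ →
      ∫ x, u x * partialDeriv i φ x = -∫ x, g x * φ x

/-- `σ ∈ W^{1,q}_loc(ℝⁿ; ℝⁿ)` with weak gradient `D`, where `D i j = ∂ᵢ σⱼ`. -/
structure MemW1Loc {n : ℕ} (σ : E n → E n) (D : Fin n → Fin n → E n → ℝ) (q : ℝ≥0∞) : Prop where
  memLpLoc : MemLpLoc σ q
  weakDeriv : ∀ i j, HasWeakPartialDeriv i (fun x => σ x j) (D i j)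
  memLpLoc_deriv : ∀ i j, MemLpLoc (D i j) q

/-- The pointwise Euclidean (Frobenius) norm `|∇σ|` of the matrix `D i j = ∂ᵢ σⱼ`. -/
noncomputable def gradNorm {n : ℕ} (D : Fin n → Fin n → E n → ℝ) (x : E n) : ℝ :=
  Real.sqrt (∑ i, ∑ j, D i j x ^ 2)

/-- The divergence `∂ᵢ σᵢ`, in terms of `D i j = ∂ᵢ σⱼ`. -/
noncomputable def divergence {n : ℕ} (D : Fin n → Fin n → E n → ℝ) (x : E n) : ℝ :=
  ∑ i, D i i x

/-- `u ε → g` in `L^r_loc(ℝⁿ)` as `ε → 0⁺`; membership in `L^r_loc` is part of the claim. -/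
def TendstoLpLoc {n : ℕ} (u : ℝ → E n → ℝ) (g : E n → ℝ) (r : ℝ≥0∞) : Prop :=
  (∀ ε : ℝ, 0 < ε → MemLpLoc (u ε) r) ∧ MemLpLoc g r ∧
    ∀ K : Set (E n), IsCompact K →
      Tendsto (fun ε : ℝ => eLpNorm (fun x => u ε x - g x) r (volume.restrict K)) (𝓝[>] 0) (𝓝 0)

/-- `η` is smooth, nonnegative, symmetric, supported in the unit ball and of unit integral. -/
structure IsMollifierProfile {n : ℕ} (η : E n → ℝ) : Prop where
  contDiff : ContDiff ℝ ∞ η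
  nonneg : ∀ x, 0 ≤ η x
  symmetric : ∀ x, η (-x) = η x
  support_subset : Function.support η ⊆ Metric.closedBall 0 1
  integral_eq_one : ∫ x, η x = 1

/-- The rescaled mollifier `η_ε(x) = ε⁻ⁿ η(ε⁻¹ x)`. -/
noncomputable def mollifier {n : ℕ} (η : E n → ℝ) (ε : ℝ) (x : E n) : ℝ :=
  (ε ^ n)⁻¹ * η (ε⁻¹ • x)

/-- The mollification `f_ε = η_ε ⋆ f` of a function. -/
noncomputable def mollify {n : ℕ} (η : E n → ℝ) (ε : ℝ) (f : E n → ℝ) : E n → ℝ :=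
  convolution (mollifier η ε) f (ContinuousLinearMap.mul ℝ ℝ) volume

/-- The mollification `(u)_ε(x) = ⟨u, η_ε(x - ·)⟩` of a distribution, where `u` is given by its
action on test functions. -/
noncomputable def mollifyDistribution {n : ℕ} (η : E n → ℝ) (ε : ℝ) (u : (E n → ℝ) → ℝ)
    (x : E n) : ℝ :=
  u (fun y => mollifier η ε (x - y))

/-- `∇_σ φ = σ · ∇φ`. -/
noncomputable def gradAlong {n : ℕ} (σ : E n → E n) (φ : E n → ℝ) (x : E n) : ℝ :=
  ∑ i, σ x i * partialDeriv i φ x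

/-- `ℒ_σ φ = ½ σᵢ σⱼ ∂ᵢ ∂ⱼ φ`. -/
noncomputable def secondAlong {n : ℕ} (σ : E n → E n) (φ : E n → ℝ) (x : E n) : ℝ :=
  (1 / 2) * ∑ i, ∑ j, σ x i * σ x j * partialDeriv i (partialDeriv j φ) x

/-- The distribution `div(σ f)`: `⟨div(σ f), φ⟩ = -∫ f σ · ∇φ`. -/
noncomputable def divDistribution {n : ℕ} (σ : E n → E n) (f : E n → ℝ) (φ : E n → ℝ) : ℝ :=
  -∫ y, f y * gradAlong σ φ y

/-- The distribution `ℒ*_σ f = ½ ∂ᵢ ∂ⱼ (σᵢ σⱼ f)`: `⟨ℒ*_σ f, φ⟩ = ∫ f ℒ_σ φ`. -/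
noncomputable def adjointDistribution {n : ℕ} (σ : E n → E n) (f : E n → ℝ) (φ : E n → ℝ) : ℝ :=
  ∫ y, f y * secondAlong σ φ y

/-- `T_{σ,ε}(f) = σ · ∇f_ε - (div(σ f))_ε`. -/
noncomputable def T {n : ℕ} (η : E n → ℝ) (σ : E n → E n) (ε : ℝ) (f : E n → ℝ) (x : E n) : ℝ :=
  gradAlong σ (mollify η ε f) x - mollifyDistribution η ε (divDistribution σ f) x

/-- `S_{σ,ε}(f) = ℒ_σ f_ε - σ · ∇(div(σ f))_ε + (ℒ*_σ f)_ε`. -/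
noncomputable def S {n : ℕ} (η : E n → ℝ) (σ : E n → E n) (ε : ℝ) (f : E n → ℝ) (x : E n) : ℝ :=
  secondAlong σ (mollify η ε f) x
    - gradAlong σ (mollifyDistribution η ε (divDistribution σ f)) x
    + mollifyDistribution η ε (adjointDistribution σ f) x

end Commutator

/-! Both `T` and `S` are convolutions in disguise. Once all derivatives sit on the mollifier, their
terms combine into increments of `σ`: with `δσ = σ(x) - σ(x - εz)`, `T` is the sum over `i` of the
integrals over the unit ball of `ε⁻¹ ∂ᵢη(z) f(x - εz) δσᵢ`, and `S` is half the sum over `i, j` of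
the integrals of `ε⁻² ∂ᵢ∂ⱼη(z) f(x - εz) δσᵢ δσⱼ` (`T_eq_sum_integral`, `S_eq_sum_integral`).

A Sobolev function satisfies `u(x) - u(x - h) = ∑ hₖ ∫₀¹ ∂ₖu(x - sh) ds` for almost every `x`
(`ae_sub_translate_eq`). With `h = εz`, each increment gives a factor `ε` that cancels one `ε⁻¹`.
What remains is a finite sum of averages `∫ w(z) P(εz, x) dz`, where the weights `w` depend only on
`η` and `P(h, ·)` is a product of a translate of `f` and one or two segment averages of `∇σ`. This
is recorded in `KernelRepresentation`.

The bounds are then Minkowski's integral inequality plus Hölder, since translating by at most `ε`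
enlarges `K` to at most `K_ε`. For the limits, translations are continuous in `L^t` for finite `t`,
so `P(h, ·)` tends to its value at `h = 0`; the factors are the moments of `∂ᵢη` and `∂ᵢ∂ⱼη`,
computed by integration by parts.

The exponents `p` and `q` may be infinite while `r` is finite, and translation is not continuous in
`L^∞`. The notion `BddTendsto`, boundedness in `L^p` with convergence in every smaller finite
exponent, includes that case and is stable under Hölder products (`BddTendsto.mul`). -/

namespace Commutator

variable {n : ℕ}

/-! ### Minkowski's integral inequality over a finite measure -/

section Minkowski

variable {X Z : Type*} [MeasurableSpace X] [MeasurableSpace Z] {μ : Measure X} {ν : Measure Z}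

/-- For finite `r` this is Jensen in `z` followed by Tonelli; for `r = ∞` it is Fubini for null
sets. Keeping the inner integral in `ℝ≥0∞` lets the same bound yield integrability of almost every
slice. -/
theorem eLpNorm_lintegral_enorm_le [SFinite μ] [IsFiniteMeasure ν] {g : X → Z → ℝ}
    (hg : StronglyMeasurable (Function.uncurry g)) {r M : ℝ≥0∞} (hr : 1 ≤ r)
    (h : ∀ᵐ z ∂ν, eLpNorm (fun x => g x z) r μ ≤ M) :
    eLpNorm (fun x => ∫⁻ z, ‖g x z‖ₑ ∂ν) r μ ≤ ν Set.univ * M := by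
  have hm : Measurable (Function.uncurry fun x z => ‖g x z‖ₑ) := hg.measurable.enorm
  by_cases hr' : r = ⊤
  · subst hr'
    simp only [eLpNorm_exponent_top] at h ⊢
    have h1 : ∀ᵐ z ∂ν, ∀ᵐ x ∂μ, ‖g x z‖ₑ ≤ M := by
      filter_upwards [h] with z hz
      filter_upwards [enorm_ae_le_eLpNormEssSup (fun x => g x z) μ] with x hx
      exact hx.trans hz
    have h2 : ∀ᵐ x ∂μ, ∀ᵐ z ∂ν, ‖g x z‖ₑ ≤ M :=
      (Measure.ae_ae_comm (p := fun x z => ‖g x z‖ₑ ≤ M) (measurableSet_le hm measurable_const)).2 h1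
    refine essSup_le_of_ae_le _ ?_
    filter_upwards [h2] with x hx
    calc ‖∫⁻ z, ‖g x z‖ₑ ∂ν‖ₑ = ∫⁻ z, ‖g x z‖ₑ ∂ν := by simp
      _ ≤ ∫⁻ _, M ∂ν := lintegral_mono_ae hx
      _ = ν Set.univ * M := by rw [lintegral_const, mul_comm]
  · have hr0 : r ≠ 0 := (zero_lt_one.trans_le hr).ne'
    have hρ : 1 ≤ r.toReal := by
      rwa [← ENNReal.toReal_one, ENNReal.toReal_le_toReal ENNReal.one_ne_top hr']
    have hρ0 : 0 < r.toReal := zero_lt_one.trans_le hρ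
    set ρ := r.toReal
    -- Jensen's inequality, read off from the comparison of the `L¹` and `L^ρ` norms for `ν`.
    have key : ∀ x, (∫⁻ z, ‖g x z‖ₑ ∂ν) ^ ρ ≤
        ν Set.univ ^ (ρ - 1) * ∫⁻ z, ‖g x z‖ₑ ^ ρ ∂ν := by
      intro x
      have := eLpNorm'_le_eLpNorm'_mul_rpow_measure_univ (μ := ν) (f := g x) zero_lt_one hρ
        (hg.comp_measurable measurable_prodMk_left).aestronglyMeasurable
      simp only [eLpNorm', ENNReal.rpow_one, div_one] at this
      calc (∫⁻ z, ‖g x z‖ₑ ∂ν) ^ ρ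
          ≤ ((∫⁻ z, ‖g x z‖ₑ ^ ρ ∂ν) ^ (1 / ρ) * ν Set.univ ^ (1 - 1 / ρ)) ^ ρ := by gcongr
        _ = _ := by
          rw [ENNReal.mul_rpow_of_nonneg _ _ hρ0.le, ← ENNReal.rpow_mul, ← ENNReal.rpow_mul,
            one_div, inv_mul_cancel₀ hρ0.ne', ENNReal.rpow_one, sub_mul,
            inv_mul_cancel₀ hρ0.ne', one_mul, mul_comm]
    rw [← ENNReal.rpow_le_rpow_iff hρ0, eLpNorm_eq_lintegral_rpow_enorm_toReal hr0 hr',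
      ← ENNReal.rpow_mul, one_div, inv_mul_cancel₀ hρ0.ne', ENNReal.rpow_one]
    calc ∫⁻ x, ‖∫⁻ z, ‖g x z‖ₑ ∂ν‖ₑ ^ ρ ∂μ
        ≤ ∫⁻ x, ν Set.univ ^ (ρ - 1) * ∫⁻ z, ‖g x z‖ₑ ^ ρ ∂ν ∂μ :=
          lintegral_mono fun x => by simpa using key x
      _ = ν Set.univ ^ (ρ - 1) * ∫⁻ z, ∫⁻ x, ‖g x z‖ₑ ^ ρ ∂μ ∂ν := by
          rw [lintegral_const_mul _ (Measurable.lintegral_prod_right (hm.pow_const ρ)),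
            lintegral_lintegral_swap (hm.pow_const ρ).aemeasurable]
      _ ≤ ν Set.univ ^ (ρ - 1) * ∫⁻ _, M ^ ρ ∂ν := by
          refine mul_le_mul' le_rfl (lintegral_mono_ae ?_)
          filter_upwards [h] with z hz
          rw [eLpNorm_eq_lintegral_rpow_enorm_toReal hr0 hr'] at hz
          calc ∫⁻ x, ‖g x z‖ₑ ^ ρ ∂μ = ((∫⁻ x, ‖g x z‖ₑ ^ ρ ∂μ) ^ (1 / ρ)) ^ ρ := by
                rw [← ENNReal.rpow_mul, one_div, inv_mul_cancel₀ hρ0.ne', ENNReal.rpow_one]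
            _ ≤ M ^ ρ := by gcongr
      _ = (ν Set.univ * M) ^ ρ := by
          rw [lintegral_const, ENNReal.mul_rpow_of_nonneg _ _ hρ0.le]
          rw [mul_comm (M ^ ρ), ← mul_assoc]
          congr 1
          conv_lhs => rw [← ENNReal.rpow_one (ν Set.univ), ← ENNReal.rpow_mul, one_mul]
          rw [← ENNReal.rpow_add_of_nonneg _ _ (by linarith) zero_le_one]
          simp

theorem eLpNorm_integral_le [SFinite μ] [IsFiniteMeasure ν] {g : X → Z → ℝ}
    (hg : StronglyMeasurable (Function.uncurry g)) {r M : ℝ≥0∞} (hr : 1 ≤ r)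
    (h : ∀ᵐ z ∂ν, eLpNorm (fun x => g x z) r μ ≤ M) :
    eLpNorm (fun x => ∫ z, g x z ∂ν) r μ ≤ ν Set.univ * M := by
  refine le_trans (eLpNorm_mono_enorm fun x => ?_) (eLpNorm_lintegral_enorm_le hg hr h)
  simpa using enorm_integral_le_lintegral_enorm (g x)

theorem ae_integrable_of_eLpNorm_le [SFinite μ] [IsFiniteMeasure ν] {g : X → Z → ℝ}
    (hg : StronglyMeasurable (Function.uncurry g)) {r M : ℝ≥0∞} (hr : 1 ≤ r) (hM : M ≠ ⊤)
    (h : ∀ᵐ z ∂ν, eLpNorm (fun x => g x z) r μ ≤ M) :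
    ∀ᵐ x ∂μ, Integrable (g x) ν := by
  have hm : Measurable (Function.uncurry fun x z => ‖g x z‖ₑ) := hg.measurable.enorm
  have h1 : eLpNorm (fun x => ∫⁻ z, ‖g x z‖ₑ ∂ν) r μ < ⊤ :=
    (eLpNorm_lintegral_enorm_le hg hr h).trans_lt (ENNReal.mul_lt_top (measure_lt_top _ _) hM.lt_top)
  have h2 : ∀ᵐ x ∂μ, ∫⁻ z, ‖g x z‖ₑ ∂ν < ⊤ := by
    by_cases hr' : r = ⊤
    · subst hr'
      filter_upwards [enorm_ae_le_eLpNormEssSup (fun x => ∫⁻ z, ‖g x z‖ₑ ∂ν) μ] with x hx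
      exact lt_of_le_of_lt (by simpa using hx) (by simpa using h1)
    · have hr0 : r ≠ 0 := (zero_lt_one.trans_le hr).ne'
      have h3 := lintegral_rpow_enorm_lt_top_of_eLpNorm_lt_top hr0 hr' h1
      have hρ0 : 0 < r.toReal := ENNReal.toReal_pos hr0 hr'
      filter_upwards [ae_lt_top ((Measurable.lintegral_prod_right hm).enorm.pow_const _) h3.ne]
        with x hx
      simpa [ENNReal.rpow_lt_top_iff_of_pos hρ0] using hx
  filter_upwards [h2] with x hx
  exact ⟨(hg.comp_measurable measurable_prodMk_left).aestronglyMeasurable, hx⟩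

end Minkowski

/-- `u i → u₀` boundedly in `L^p`: the family is bounded in `L^p` and converges in `L^t` for all
finite exponents `t ≤ p`. -/
structure BddTendsto {ι X : Type*} [MeasurableSpace X] (l : Filter ι) (u : ι → X → ℝ) (u₀ : X → ℝ)
    (p : ℝ≥0∞) (μ : Measure X) : Prop where
  meas : ∀ i, AEStronglyMeasurable (u i) μ
  memLp : MemLp u₀ p μ
  bdd : ∃ M : ℝ≥0∞, M ≠ ⊤ ∧ ∀ᶠ i in l, eLpNorm (u i) p μ ≤ M
  tendsto : ∀ t : ℝ≥0∞, 1 ≤ t → t ≤ p → t ≠ ⊤ →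
    Tendsto (fun i => eLpNorm (fun x => u i x - u₀ x) t μ) l (𝓝 0)

/-! ### Hölder products of boundedly convergent families -/

section BddTendsto

variable {ι X : Type*} [MeasurableSpace X] {l : Filter ι} {μ : Measure X}

theorem eLpNorm_mul_le_mul {p q r : ℝ≥0∞} [ENNReal.HolderTriple p q r] {f g : X → ℝ}
    (hf : AEStronglyMeasurable f μ) (hg : AEStronglyMeasurable g μ) :
    eLpNorm (fun x => f x * g x) r μ ≤ eLpNorm f p μ * eLpNorm g q μ :=
  eLpNorm_smul_le_mul_eLpNorm (p := p) (q := q) (r := r) (f := g) (φ := f) hg hf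

/-- Split `v` into a simple function and a remainder small in `L^t`. The simple part is bounded and
multiplies something tending to zero in `L^t`; the remainder is multiplied by something bounded. No
almost everywhere convergence of `w` is needed. -/
theorem tendsto_eLpNorm_mul_of_bounded {w : ι → X → ℝ} {v : X → ℝ} {t M : ℝ≥0∞}
    (ht : 1 ≤ t) (ht' : t ≠ ⊤) (hM : M ≠ ⊤) (hw : ∀ i, AEStronglyMeasurable (w i) μ)
    (hwM : ∀ᶠ i in l, eLpNorm (w i) ⊤ μ ≤ M)
    (hwt : Tendsto (fun i => eLpNorm (w i) t μ) l (𝓝 0)) (hv : MemLp v t μ) :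
    Tendsto (fun i => eLpNorm (fun x => w i x * v x) t μ) l (𝓝 0) := by
  rw [ENNReal.tendsto_nhds_zero]
  intro δ hδ
  by_cases hδt : δ = ⊤
  · simp [hδt]
  have hδ2 : δ / 2 ≠ 0 := (ENNReal.half_pos hδ.ne').ne'
  -- Dividing by `M + 1` instead of `M` allows `M = 0`.
  have hδ' : δ / 2 / (M + 1) ≠ 0 := ENNReal.div_ne_zero.2 ⟨hδ2, by simp [hM]⟩
  obtain ⟨φ, hφ, hφm⟩ := hv.exists_simpleFunc_eLpNorm_sub_lt ht' hδ'
  have hφtop : eLpNorm φ ⊤ μ < ⊤ := (φ.memLp_top μ).2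
  have h0 : Tendsto (fun i => eLpNorm φ ⊤ μ * eLpNorm (w i) t μ) l (𝓝 0) := by
    simpa using ENNReal.Tendsto.const_mul hwt (Or.inr hφtop.ne)
  filter_upwards [hwM, ENNReal.tendsto_nhds_zero.1 h0 (δ / 2) (pos_iff_ne_zero.2 hδ2)] with i hi hi'
  have hsub : AEStronglyMeasurable (fun x => v x - φ x) μ := hv.1.sub φ.aestronglyMeasurable
  calc eLpNorm (fun x => w i x * v x) t μ
      = eLpNorm ((fun x => w i x * (v x - φ x)) + fun x => φ x * w i x) t μ := by
        congr 1; ext x; simp only [Pi.add_apply]; ring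
    _ ≤ eLpNorm (fun x => w i x * (v x - φ x)) t μ + eLpNorm (fun x => φ x * w i x) t μ :=
        eLpNorm_add_le ((hw i).mul hsub) (φ.aestronglyMeasurable.mul (hw i)) ht
    _ ≤ eLpNorm (w i) ⊤ μ * eLpNorm (fun x => v x - φ x) t μ + eLpNorm φ ⊤ μ * eLpNorm (w i) t μ :=
        add_le_add (eLpNorm_mul_le_mul (hw i) hsub)
          (eLpNorm_mul_le_mul φ.aestronglyMeasurable (hw i))
    _ ≤ (M + 1) * (δ / 2 / (M + 1)) + δ / 2 := by
        gcongr
        · exact hi.trans le_self_add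
        · exact hφ.le
    _ = δ := by
        rw [ENNReal.mul_div_cancel (by simp) (by simp [hM]), ENNReal.add_halves]

theorem BddTendsto.eventually_sub_le {u : ι → X → ℝ} {u₀ : X → ℝ} {p : ℝ≥0∞} (hp : 1 ≤ p)
    (hu : BddTendsto l u u₀ p μ) :
    ∃ M : ℝ≥0∞, M ≠ ⊤ ∧ ∀ᶠ i in l, eLpNorm (fun x => u i x - u₀ x) p μ ≤ M := by
  obtain ⟨M, hM, h⟩ := hu.bdd
  refine ⟨M + eLpNorm u₀ p μ, ENNReal.add_ne_top.2 ⟨hM, hu.memLp.2.ne⟩, ?_⟩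
  filter_upwards [h] with i hi
  exact (eLpNorm_sub_le (hu.meas i) hu.memLp.1 hp).trans (add_le_add hi le_rfl)

/-- In `u v - u₀ v₀ = u (v - v₀) + (u - u₀) v₀` the last term escapes Hölder, because `u - u₀` need
not be small in `L^∞`; it is handled by the preceding density argument. -/
theorem BddTendsto.tendsto_mul_of_top [IsFiniteMeasure μ] {u v : ι → X → ℝ} {u₀ v₀ : X → ℝ}
    {q t : ℝ≥0∞} (ht : 1 ≤ t) (htq : t ≤ q) (ht' : t ≠ ⊤)
    (hu : BddTendsto l u u₀ ⊤ μ) (hv : BddTendsto l v v₀ q μ) :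
    Tendsto (fun i => eLpNorm (fun x => u i x * v i x - u₀ x * v₀ x) t μ) l (𝓝 0) := by
  obtain ⟨M, hM, hub⟩ := hu.bdd
  obtain ⟨M', hM', hub'⟩ := hu.eventually_sub_le le_top
  have h1 : Tendsto (fun i => M * eLpNorm (fun x => v i x - v₀ x) t μ) l (𝓝 0) := by
    simpa using ENNReal.Tendsto.const_mul (hv.tendsto t ht htq ht') (Or.inr hM)
  have h2 := tendsto_eLpNorm_mul_of_bounded ht ht' hM'
    (fun i => (hu.meas i).sub hu.memLp.1) hub' (hu.tendsto t ht le_top ht')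
    (hv.memLp.mono_exponent htq)
  have h3 := h1.add h2
  rw [add_zero] at h3
  refine tendsto_of_tendsto_of_tendsto_of_le_of_le' tendsto_const_nhds h3
    (Eventually.of_forall fun _ => zero_le) ?_
  filter_upwards [hub] with i hi
  have m1 : AEStronglyMeasurable (fun x => v i x - v₀ x) μ := (hv.meas i).sub hv.memLp.1
  have m2 : AEStronglyMeasurable (fun x => u i x - u₀ x) μ := (hu.meas i).sub hu.memLp.1
  calc eLpNorm (fun x => u i x * v i x - u₀ x * v₀ x) t μ
      = eLpNorm ((fun x => u i x * (v i x - v₀ x)) + fun x => (u i x - u₀ x) * v₀ x) t μ := by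
        congr 1; ext x; simp only [Pi.add_apply]; ring
    _ ≤ eLpNorm (fun x => u i x * (v i x - v₀ x)) t μ
        + eLpNorm (fun x => (u i x - u₀ x) * v₀ x) t μ :=
        eLpNorm_add_le ((hu.meas i).mul m1) (m2.mul hv.memLp.1) ht
    _ ≤ M * eLpNorm (fun x => v i x - v₀ x) t μ
        + eLpNorm (fun x => (u i x - u₀ x) * v₀ x) t μ := by
        gcongr
        exact (eLpNorm_mul_le_mul (p := ⊤) (hu.meas i) m1).trans (by gcongr)

theorem BddTendsto.mul [IsFiniteMeasure μ] {u v : ι → X → ℝ} {u₀ v₀ : X → ℝ} {p q r : ℝ≥0∞}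
    [hpqr : ENNReal.HolderTriple p q r] (hr : 1 ≤ r)
    (hu : BddTendsto l u u₀ p μ) (hv : BddTendsto l v v₀ q μ) :
    BddTendsto l (fun i x => u i x * v i x) (fun x => u₀ x * v₀ x) r μ where
  meas i := (hu.meas i).mul (hv.meas i)
  memLp := hv.memLp.mul' hu.memLp
  bdd := by
    obtain ⟨M, hM, h⟩ := hu.bdd
    obtain ⟨M', hM', h'⟩ := hv.bdd
    refine ⟨M * M', ENNReal.mul_ne_top hM hM', ?_⟩
    filter_upwards [h, h'] with i hi hi'
    exact (eLpNorm_mul_le_mul (hu.meas i) (hv.meas i)).trans (mul_le_mul' hi hi')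
  tendsto := by
    intro t ht htr ht'
    have hrp : r ≤ p := ENNReal.HolderTriple.le p q r
    have hrq : r ≤ q := ENNReal.HolderTriple.le q p r
    by_cases hp : p = ⊤
    · subst hp
      exact hu.tendsto_mul_of_top ht (htr.trans hrq) ht' hv
    by_cases hq : q = ⊤
    · subst hq
      simpa only [mul_comm] using hv.tendsto_mul_of_top ht (htr.trans hrp) ht' hu
    have hr' : r ≠ ⊤ := ne_top_of_le_ne_top hp hrp
    -- With both exponents finite, Hölder gives convergence in `L^r` itself; finiteness of the
    -- measure then lowers `r` to `t`.
    have key : Tendsto (fun i => eLpNorm (fun x => u i x * v i x - u₀ x * v₀ x) r μ) l (𝓝 0) := by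
      obtain ⟨M, hM, hub⟩ := hu.bdd
      have h1 : Tendsto (fun i => M * eLpNorm (fun x => v i x - v₀ x) q μ) l (𝓝 0) := by
        simpa using ENNReal.Tendsto.const_mul (hv.tendsto q (hr.trans hrq) le_rfl hq) (Or.inr hM)
      have h2 : Tendsto (fun i => eLpNorm (fun x => u i x - u₀ x) p μ * eLpNorm v₀ q μ)
          l (𝓝 0) := by
        simpa using ENNReal.Tendsto.mul_const (hu.tendsto p (hr.trans hrp) le_rfl hp)
          (Or.inr hv.memLp.2.ne)
      have h3 := h1.add h2
      rw [add_zero] at h3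
      refine tendsto_of_tendsto_of_tendsto_of_le_of_le' tendsto_const_nhds h3
        (Eventually.of_forall fun _ => zero_le) ?_
      filter_upwards [hub] with i hi
      have m1 : AEStronglyMeasurable (fun x => v i x - v₀ x) μ := (hv.meas i).sub hv.memLp.1
      have m2 : AEStronglyMeasurable (fun x => u i x - u₀ x) μ := (hu.meas i).sub hu.memLp.1
      calc eLpNorm (fun x => u i x * v i x - u₀ x * v₀ x) r μ
          = eLpNorm ((fun x => u i x * (v i x - v₀ x)) + fun x => (u i x - u₀ x) * v₀ x) r μ := by
            congr 1; ext x; simp only [Pi.add_apply]; ring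
        _ ≤ eLpNorm (fun x => u i x * (v i x - v₀ x)) r μ
            + eLpNorm (fun x => (u i x - u₀ x) * v₀ x) r μ :=
            eLpNorm_add_le ((hu.meas i).mul m1) (m2.mul hv.memLp.1) hr
        _ ≤ eLpNorm (u i) p μ * eLpNorm (fun x => v i x - v₀ x) q μ
            + eLpNorm (fun x => u i x - u₀ x) p μ * eLpNorm v₀ q μ :=
            add_le_add (eLpNorm_mul_le_mul (hu.meas i) m1) (eLpNorm_mul_le_mul m2 hv.memLp.1)
        _ ≤ _ := by gcongr
    have hc : μ Set.univ ^ (1 / t.toReal - 1 / r.toReal) ≠ ⊤ := by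
      refine ENNReal.rpow_ne_top_of_nonneg ?_ (measure_ne_top _ _)
      rw [sub_nonneg]
      exact one_div_le_one_div_of_le (ENNReal.toReal_pos (zero_lt_one.trans_le ht).ne' ht')
        (ENNReal.toReal_mono hr' htr)
    have h4 : Tendsto (fun i => eLpNorm (fun x => u i x * v i x - u₀ x * v₀ x) r μ
        * μ Set.univ ^ (1 / t.toReal - 1 / r.toReal)) l (𝓝 0) := by
      simpa using ENNReal.Tendsto.mul_const key (Or.inr hc)
    refine tendsto_of_tendsto_of_tendsto_of_le_of_le tendsto_const_nhds h4
      (fun _ => zero_le) fun i => ?_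
    exact eLpNorm_le_eLpNorm_mul_rpow_measure_univ htr
      (((hu.meas i).mul (hv.meas i)).sub (hu.memLp.1.mul hv.memLp.1))

end BddTendsto

/-! ### Translations and segment averages in local `L^p` spaces -/

theorem eLpNorm_translate_le {f : E n → ℝ} (hf : StronglyMeasurable f) (p : ℝ≥0∞) (K : Set (E n))
    {ε : ℝ} {h : E n} (hh : ‖h‖ ≤ ε) :
    eLpNorm (fun x => f (x - h)) p (volume.restrict K) ≤
      eLpNorm f p (volume.restrict (Metric.cthickening ε K)) := by
  have hm : MeasurableSet (Metric.cthickening ε K) := Metric.isClosed_cthickening.measurableSet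
  have hsub : K ⊆ (fun x => x - h) ⁻¹' Metric.cthickening ε K := fun x hx =>
    Metric.mem_cthickening_of_dist_le (x - h) x ε K hx (by simpa [dist_eq_norm] using hh)
  calc eLpNorm (fun x => f (x - h)) p (volume.restrict K)
      ≤ eLpNorm (f ∘ fun x => x - h) p
          (volume.restrict ((fun x => x - h) ⁻¹' Metric.cthickening ε K)) :=
        eLpNorm_mono_measure _ (Measure.restrict_mono hsub le_rfl)
    _ = _ := eLpNorm_comp_measurePreserving hf.aestronglyMeasurable
        ((measurePreserving_sub_right volume h).restrict_preimage hm)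

theorem tendsto_eLpNorm_translate_sub {f : E n → ℝ} {t : ℝ≥0∞} (ht : 1 ≤ t) (ht' : t ≠ ⊤)
    (hf : MemLp f t volume) :
    Tendsto (fun h : E n => eLpNorm (fun x => f (x - h) - f x) t volume) (𝓝 0) (𝓝 0) := by
  have : Fact (1 ≤ t) := ⟨ht⟩
  -- The translation by `-h`, as an element of the space of continuous maps, depends continuously on
  -- `h`; composition with measure preserving maps is continuous in `L^t` for such families.
  let g : C(E n, C(E n, E n)) := ContinuousMap.curry ⟨fun a => a.2 - a.1, by fun_prop⟩
  have hg : ∀ h, MeasurePreserving (g h) (volume : Measure (E n)) volume := fun h =>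
    measurePreserving_sub_right volume h
  have h1 : Continuous fun h : E n => Lp.compMeasurePreserving (g h) (hg h) hf.toLp :=
    continuous_const.compMeasurePreservingLp g.continuous hg ht'
  have h2 := (tendsto_iff_edist_tendsto_0.1 (h1.tendsto 0))
  refine h2.congr fun h => ?_
  rw [Lp.edist_def]
  refine eLpNorm_congr_ae ?_
  have e : ∀ k : E n, (Lp.compMeasurePreserving (g k) (hg k) hf.toLp : E n → ℝ)
      =ᵐ[volume] fun x => f (x - k) := fun k =>
    (Lp.coeFn_compMeasurePreserving _ (hg k)).trans
      ((hg k).quasiMeasurePreserving.ae_eq_comp hf.coeFn_toLp)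
  filter_upwards [e h, e 0] with x hx hx0
  exact (congrArg₂ (· - ·) hx hx0).trans (by simp)

/-- For `‖h‖ ≤ 1` only values of `f` on the unit thickening of `K` matter on `K`, so `f` can be cut
off there and the global continuity of translations applies. -/
theorem MemLpLoc.bddTendsto_translate {f : E n → ℝ} (hfm : StronglyMeasurable f) {p : ℝ≥0∞}
    (hf : MemLpLoc f p) {K : Set (E n)} (hK : IsCompact K) :
    BddTendsto (𝓝 0) (fun h x => f (x - h)) f p (volume.restrict K) where
  meas h := (hfm.comp_measurable (measurable_id.sub_const h)).aestronglyMeasurable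
  memLp := hf K hK
  bdd := by
    refine ⟨_, (hf _ (hK.cthickening (r := 1))).2.ne, ?_⟩
    filter_upwards [Metric.closedBall_mem_nhds (0 : E n) one_pos] with h hh
    exact eLpNorm_translate_le hfm p K (by simpa using hh)
  tendsto t ht htp ht' := by
    set K' := Metric.cthickening 1 K
    have hK' : IsCompact K' := hK.cthickening
    have : IsFiniteMeasure (volume.restrict K') := ⟨by simpa using hK'.measure_lt_top⟩
    have hKK' : K ⊆ K' := Metric.self_subset_cthickening K
    have hF : MemLp (K'.indicator f) t volume :=
      (memLp_indicator_iff_restrict hK'.isClosed.measurableSet).2 ((hf K' hK').mono_exponent htp)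
    refine tendsto_of_tendsto_of_tendsto_of_le_of_le' tendsto_const_nhds
      (tendsto_eLpNorm_translate_sub ht ht' hF) (Eventually.of_forall fun _ => zero_le) ?_
    filter_upwards [Metric.closedBall_mem_nhds (0 : E n) one_pos] with h hh
    calc eLpNorm (fun x => f (x - h) - f x) t (volume.restrict K)
        = eLpNorm (fun x => K'.indicator f (x - h) - K'.indicator f x) t (volume.restrict K) := by
          refine eLpNorm_congr_ae ?_
          filter_upwards [ae_restrict_mem hK.isClosed.measurableSet] with x hx
          have hx' : x - h ∈ K' := Metric.mem_cthickening_of_dist_le (x - h) x 1 K hx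
            (by simpa [dist_eq_norm] using hh)
          rw [Set.indicator_of_mem hx', Set.indicator_of_mem (hKK' hx)]
      _ ≤ _ := eLpNorm_mono_measure _ Measure.restrict_le_self

/-- The average of `D` over the segment from `x - h` to `x`. -/
noncomputable def segmentAverage (D : E n → ℝ) (h x : E n) : ℝ :=
  ∫ s in Set.Icc (0 : ℝ) 1, D (x - s • h)

theorem stronglyMeasurable_segmentAverage {D : E n → ℝ} (hD : StronglyMeasurable D) :
    StronglyMeasurable (Function.uncurry (segmentAverage D)) := by
  have : StronglyMeasurable (Function.uncurry fun (a : E n × E n) (s : ℝ) => D (a.2 - s • a.1)) :=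
    hD.comp_measurable (by fun_prop)
  exact this.integral_prod_right

theorem stronglyMeasurable_segment {D : E n → ℝ} (hD : StronglyMeasurable D) (h : E n) :
    StronglyMeasurable (Function.uncurry fun (x : E n) (s : ℝ) => D (x - s • h)) :=
  hD.comp_measurable (by fun_prop)

theorem ae_eLpNorm_segment_le {D : E n → ℝ} (hD : StronglyMeasurable D) (p : ℝ≥0∞)
    (K : Set (E n)) {ε : ℝ} {h : E n} (hh : ‖h‖ ≤ ε) :
    ∀ᵐ s ∂(volume.restrict (Set.Icc (0 : ℝ) 1)),
      eLpNorm (fun x => D (x - s • h)) p (volume.restrict K) ≤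
        eLpNorm D p (volume.restrict (Metric.cthickening ε K)) := by
  filter_upwards [ae_restrict_mem measurableSet_Icc] with s hs
  refine eLpNorm_translate_le hD p K (le_trans ?_ hh)
  rw [norm_smul, Real.norm_of_nonneg hs.1]
  exact mul_le_of_le_one_left (norm_nonneg _) hs.2

theorem eLpNorm_segmentAverage_le {D : E n → ℝ} (hD : StronglyMeasurable D) {p : ℝ≥0∞}
    (hp : 1 ≤ p) (K : Set (E n)) {ε : ℝ} {h : E n} (hh : ‖h‖ ≤ ε) :
    eLpNorm (segmentAverage D h) p (volume.restrict K) ≤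
      eLpNorm D p (volume.restrict (Metric.cthickening ε K)) :=
  (eLpNorm_integral_le (stronglyMeasurable_segment hD h) hp
    (ae_eLpNorm_segment_le hD p K hh)).trans_eq (by simp)

theorem MemLpLoc.ae_integrable_segment {D : E n → ℝ} (hDm : StronglyMeasurable D) {p : ℝ≥0∞}
    (hp : 1 ≤ p) (hD : MemLpLoc D p) {K : Set (E n)} (hK : IsCompact K) (h : E n) :
    ∀ᵐ x ∂(volume.restrict K), IntegrableOn (fun s : ℝ => D (x - s • h)) (Set.Icc 0 1) :=
  ae_integrable_of_eLpNorm_le (stronglyMeasurable_segment hDm h) hp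
    (hD _ hK.cthickening).2.ne (ae_eLpNorm_segment_le hDm p K le_rfl)

/-- Since `‖s • h‖ ≤ ‖h‖` for `s` in `[0, 1]`, closeness of translates is uniform along the segment
and passes to the average by Minkowski. -/
theorem MemLpLoc.bddTendsto_segmentAverage {D : E n → ℝ} (hDm : StronglyMeasurable D) {p : ℝ≥0∞}
    (hp : 1 ≤ p) (hD : MemLpLoc D p) {K : Set (E n)} (hK : IsCompact K) :
    BddTendsto (𝓝 0) (segmentAverage D) D p (volume.restrict K) where
  meas h := ((stronglyMeasurable_segmentAverage hDm).comp_measurable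
    measurable_prodMk_left).aestronglyMeasurable
  memLp := hD K hK
  bdd := by
    refine ⟨_, (hD _ (hK.cthickening (r := 1))).2.ne, ?_⟩
    filter_upwards [Metric.closedBall_mem_nhds (0 : E n) one_pos] with h hh
    exact eLpNorm_segmentAverage_le hDm hp K (by simpa using hh)
  tendsto t ht htp ht' := by
    have h0 := (hD.bddTendsto_translate hDm hK).tendsto t ht htp ht'
    rw [ENNReal.tendsto_nhds_zero] at h0 ⊢
    intro δ hδ
    obtain ⟨ρ, hρ, hball⟩ := Metric.eventually_nhds_iff_ball.1 (h0 δ hδ)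
    filter_upwards [Metric.ball_mem_nhds (0 : E n) hρ] with h hh
    have hm : StronglyMeasurable
        (Function.uncurry fun (x : E n) (s : ℝ) => D (x - s • h) - D x) :=
      (stronglyMeasurable_segment hDm h).sub (hDm.comp_measurable measurable_fst)
    have h1 : eLpNorm (fun x => ∫ s in Set.Icc (0 : ℝ) 1, (D (x - s • h) - D x)) t
        (volume.restrict K) ≤ δ := by
      have h2 : ∀ᵐ s ∂(volume.restrict (Set.Icc (0 : ℝ) 1)),
          eLpNorm (fun x => D (x - s • h) - D x) t (volume.restrict K) ≤ δ := by
        filter_upwards [ae_restrict_mem measurableSet_Icc] with s hs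
        refine hball (s • h) ?_
        rw [mem_ball_zero_iff] at hh ⊢
        rw [norm_smul, Real.norm_of_nonneg hs.1]
        exact (mul_le_of_le_one_left (norm_nonneg _) hs.2).trans_lt hh
      simpa using eLpNorm_integral_le hm ht h2
    refine le_of_eq_of_le (eLpNorm_congr_ae ?_) h1
    -- Almost everywhere integrability is needed here: the Bochner integral of a non-integrable
    -- function is `0` by convention, and the integral of the difference would not split.
    filter_upwards [hD.ae_integrable_segment hDm hp hK h] with x hx
    rw [integral_sub hx (by simp)]
    simp [segmentAverage]

/-- The weighted average `∫ w(z) P(ε z, x) dz` over the unit ball. -/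
noncomputable def kernelAverage (w : E n → ℝ) (P : E n → E n → ℝ) (ε : ℝ) (x : E n) : ℝ :=
  ∫ z in Metric.closedBall (0 : E n) 1, w z * P (ε • z) x

/-! ### Weighted averages over the unit ball and their limits -/

section kernelAverage

variable {w : E n → ℝ} {P : E n → E n → ℝ}

theorem stronglyMeasurable_kernel (hw : Continuous w)
    (hP : StronglyMeasurable (Function.uncurry P)) (ε : ℝ) :
    StronglyMeasurable (Function.uncurry fun (x z : E n) => w z * P (ε • z) x) := by
  have h1 : Measurable fun a : E n × E n => (ε • a.2, a.1) := by fun_prop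
  exact (hw.stronglyMeasurable.comp_measurable measurable_snd).mul (hP.comp_measurable h1)

theorem stronglyMeasurable_kernelAverage (hw : Continuous w)
    (hP : StronglyMeasurable (Function.uncurry P)) (ε : ℝ) :
    StronglyMeasurable (kernelAverage w P ε) :=
  (stronglyMeasurable_kernel hw hP ε).integral_prod_right

instance : IsFiniteMeasure (volume.restrict (Metric.closedBall (0 : E n) 1)) :=
  ⟨by simpa using measure_closedBall_lt_top⟩

theorem ae_eLpNorm_kernel_le {W : ℝ≥0} (hW : ∀ z, ‖w z‖ ≤ W) {r M : ℝ≥0∞} {K : Set (E n)} {ε : ℝ}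
    (hε : 0 < ε) (hM : ∀ h, ‖h‖ ≤ ε → eLpNorm (P h) r (volume.restrict K) ≤ M) :
    ∀ᵐ z ∂(volume.restrict (Metric.closedBall (0 : E n) 1)),
      eLpNorm (fun x => w z * P (ε • z) x) r (volume.restrict K) ≤ W * M := by
  filter_upwards [ae_restrict_mem Metric.isClosed_closedBall.measurableSet] with z hz
  have hz' : ‖ε • z‖ ≤ ε := by
    rw [norm_smul, Real.norm_of_nonneg hε.le]
    exact mul_le_of_le_one_right hε.le (by simpa using hz)
  have h1 : eLpNorm (fun x => w z * P (ε • z) x) r (volume.restrict K)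
      ≤ ‖w z‖ₑ * eLpNorm (P (ε • z)) r (volume.restrict K) :=
    eLpNorm_const_smul_le (c := w z) (f := P (ε • z))
  refine h1.trans (mul_le_mul' ?_ (hM _ hz'))
  rw [enorm_eq_nnnorm]
  exact_mod_cast hW z

theorem eLpNorm_kernelAverage_le (hw : Continuous w) {W : ℝ≥0} (hW : ∀ z, ‖w z‖ ≤ W)
    (hP : StronglyMeasurable (Function.uncurry P)) {r M : ℝ≥0∞} (hr : 1 ≤ r) {K : Set (E n)} {ε : ℝ}
    (hε : 0 < ε) (hM : ∀ h, ‖h‖ ≤ ε → eLpNorm (P h) r (volume.restrict K) ≤ M) :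
    eLpNorm (kernelAverage w P ε) r (volume.restrict K) ≤
      volume (Metric.closedBall (0 : E n) 1) * (W * M) :=
  (eLpNorm_integral_le (stronglyMeasurable_kernel hw hP ε) hr
    (ae_eLpNorm_kernel_le hW hε hM)).trans_eq (by simp)

theorem ae_integrable_kernel (hw : Continuous w) {W : ℝ≥0} (hW : ∀ z, ‖w z‖ ≤ W)
    (hP : StronglyMeasurable (Function.uncurry P)) {r M : ℝ≥0∞} (hr : 1 ≤ r) (hM' : M ≠ ⊤)
    {K : Set (E n)} {ε : ℝ} (hε : 0 < ε)
    (hM : ∀ h, ‖h‖ ≤ ε → eLpNorm (P h) r (volume.restrict K) ≤ M) :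
    ∀ᵐ x ∂(volume.restrict K),
      IntegrableOn (fun z => w z * P (ε • z) x) (Metric.closedBall (0 : E n) 1) :=
  ae_integrable_of_eLpNorm_le (stronglyMeasurable_kernel hw hP ε) hr
    (ENNReal.mul_ne_top ENNReal.coe_ne_top hM') (ae_eLpNorm_kernel_le hW hε hM)

/-- The error is itself the kernel average of `P h - P₀`, hence at most a constant times the
supremum of `‖P h - P₀‖` in `L^r(K)` over `‖h‖ ≤ ε`. -/
theorem tendsto_kernelAverage (hw : Continuous w) {W : ℝ≥0} (hW : ∀ z, ‖w z‖ ≤ W)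
    (hP : StronglyMeasurable (Function.uncurry P)) {P₀ : E n → ℝ} (hP₀ : StronglyMeasurable P₀)
    {r : ℝ≥0∞} (hr : 1 ≤ r) (hr' : r ≠ ⊤) {K : Set (E n)}
    (h : BddTendsto (𝓝 0) P P₀ r (volume.restrict K)) :
    Tendsto (fun ε => eLpNorm (fun x => kernelAverage w P ε x
        - (∫ z in Metric.closedBall (0 : E n) 1, w z) * P₀ x) r (volume.restrict K))
      (𝓝[>] 0) (𝓝 0) := by
  have h0 := h.tendsto r hr le_rfl hr'
  obtain ⟨M, hM, hbdd⟩ := h.bdd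
  set V := volume (Metric.closedBall (0 : E n) 1)
  have hV : V ≠ ⊤ := measure_closedBall_lt_top.ne
  have hQ : StronglyMeasurable (Function.uncurry fun h x => P h x - P₀ x) :=
    hP.sub (hP₀.comp_measurable measurable_snd)
  have small : ∀ {p : E n → Prop}, (∀ᶠ h in 𝓝 0, p h) →
      ∀ᶠ ε : ℝ in 𝓝[>] 0, 0 < ε ∧ ∀ h, ‖h‖ ≤ ε → p h := by
    intro p hp
    obtain ⟨ρ, hρ, hball⟩ := Metric.eventually_nhds_iff_ball.1 hp
    filter_upwards [Ioo_mem_nhdsGT hρ] with ε hε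
    exact ⟨hε.1, fun h hh => hball h (mem_ball_zero_iff.2 (hh.trans_lt hε.2))⟩
  rw [ENNReal.tendsto_nhds_zero]
  intro δ hδ
  by_cases hδt : δ = ⊤
  · simp [hδt]
  set c : ℝ≥0∞ := V * W + 1
  have hc : c ≠ ⊤ := ENNReal.add_ne_top.2 ⟨ENNReal.mul_ne_top hV ENNReal.coe_ne_top, by simp⟩
  filter_upwards [small hbdd, small (ENNReal.tendsto_nhds_zero.1 h0 (δ / c)
    (ENNReal.div_pos hδ.ne' hc))] with ε h1 h2
  have key : eLpNorm (kernelAverage w (fun h x => P h x - P₀ x) ε) r (volume.restrict K) ≤ δ := by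
    refine (eLpNorm_kernelAverage_le hw hW hQ hr h1.1 h2.2).trans ?_
    calc V * (W * (δ / c)) ≤ c * (δ / c) := by
          rw [← mul_assoc]
          exact mul_le_mul' le_self_add le_rfl
      _ = δ := ENNReal.mul_div_cancel (by simp [c]) hc
  refine le_of_eq_of_le (eLpNorm_congr_ae ?_) key
  filter_upwards [ae_integrable_kernel hw hW hP hr hM h1.1 h1.2] with x hx
  have hwi : IntegrableOn w (Metric.closedBall (0 : E n) 1) :=
    hw.continuousOn.integrableOn_compact (isCompact_closedBall 0 1)
  simp only [kernelAverage, mul_sub]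
  rw [integral_sub hx (hwi.mul_const _), integral_mul_const]

end kernelAverage

/-! ### Elementary facts on local integrability and partial derivatives -/

theorem memLpLoc_one_iff {F : Type*} [NormedAddCommGroup F] {f : E n → F} : MemLpLoc f 1 ↔ LocallyIntegrable f volume := by
  simp only [MemLpLoc, memLp_one_iff_integrable, locallyIntegrable_iff]
  rfl

theorem MemLpLoc.mono {F : Type*} [NormedAddCommGroup F] {f : E n → F} {p q : ℝ≥0∞}
    (hf : MemLpLoc f q) (hpq : p ≤ q) : MemLpLoc f p := fun K hK => by
  have : IsFiniteMeasure (volume.restrict K) := ⟨by simpa using hK.measure_lt_top⟩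
  exact (hf K hK).mono_exponent hpq

theorem MemLpLoc.locallyIntegrable {F : Type*} [NormedAddCommGroup F] {f : E n → F} {p : ℝ≥0∞}
    (hf : MemLpLoc f p) (hp : 1 ≤ p) : LocallyIntegrable f volume :=
  memLpLoc_one_iff.1 (hf.mono hp)

theorem memLpLoc_translate {f : E n → ℝ} (hfm : StronglyMeasurable f) {p : ℝ≥0∞}
    (hf : MemLpLoc f p) (h : E n) : MemLpLoc (fun x => f (x - h)) p := fun K hK =>
  ⟨(hfm.comp_measurable (measurable_id.sub_const h)).aestronglyMeasurable,
    (eLpNorm_translate_le hfm p K le_rfl).trans_lt (hf _ hK.cthickening).2⟩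

theorem memLpLoc_segmentAverage {D : E n → ℝ} (hDm : StronglyMeasurable D) {p : ℝ≥0∞}
    (hp : 1 ≤ p) (hD : MemLpLoc D p) (h : E n) : MemLpLoc (segmentAverage D h) p := fun K hK =>
  ⟨((stronglyMeasurable_segmentAverage hDm).comp_measurable
    measurable_prodMk_left).aestronglyMeasurable,
    (eLpNorm_segmentAverage_le hDm hp K le_rfl).trans_lt (hD _ hK.cthickening).2⟩

theorem contDiff_partialDeriv {φ : E n → ℝ} (hφ : ContDiff ℝ ∞ φ) (i : Fin n) :
    ContDiff ℝ ∞ (partialDeriv i φ) :=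
  (hφ.fderiv_right (m := ∞) (by simp)).clm_apply contDiff_const

theorem hasCompactSupport_partialDeriv {φ : E n → ℝ} (hφ : HasCompactSupport φ) (i : Fin n) :
    HasCompactSupport (partialDeriv i φ) :=
  hφ.fderiv_apply (𝕜 := ℝ) (EuclideanSpace.single i (1 : ℝ))

theorem fderiv_eq_sum_partialDeriv (φ : E n → ℝ) (x h : E n) :
    fderiv ℝ φ x h = ∑ k, h k * partialDeriv k φ x := by
  have : h = ∑ k, h k • EuclideanSpace.single k (1 : ℝ) := by
    ext j
    simp [Finset.sum_apply, Pi.single_apply]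
  conv_lhs => rw [this]
  simp [partialDeriv]

theorem partialDeriv_comp_add_right (φ : E n → ℝ) (k : Fin n) (a x : E n) :
    partialDeriv k (fun y => φ (y + a)) x = partialDeriv k φ (x + a) := by
  simp [partialDeriv, fderiv_comp_add_right]

theorem integrable_mul_of_hasCompactSupport {G φ : E n → ℝ} (hG : LocallyIntegrable G volume)
    (hφ : Continuous φ) (hφc : HasCompactSupport φ) : Integrable (fun x => G x * φ x) volume := by
  simpa only [smul_eq_mul, mul_comm] using hG.integrable_smul_left_of_hasCompactSupport hφ hφc

/-! ### Increments of Sobolev functions along segments -/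

section Segment

variable {G φ : E n → ℝ}

/-- For `s` in `[0, 1]`, the factor `φ(x + sh)` vanishes unless `x` lies within `‖h‖` of the support
of `φ`; a constant times `‖G‖` on that compact set dominates. This justifies the Fubini swaps below.
-/
theorem integrable_prod_mul_translate (hG : LocallyIntegrable G volume)
    (hφ : Continuous φ) (hφc : HasCompactSupport φ) (h : E n) :
    Integrable (fun a : ℝ × E n => G a.2 * φ (a.2 + a.1 • h))
      ((volume.restrict (Set.Icc (0 : ℝ) 1)).prod volume) := by
  obtain ⟨C, hC⟩ := hφ.bounded_above_of_compact_support hφc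
  set K := Metric.cthickening ‖h‖ (tsupport φ)
  have hK : IsCompact K := hφc.isCompact.cthickening
  have hKm : MeasurableSet K := hK.isClosed.measurableSet
  have h1 : Integrable (K.indicator fun x => C * ‖G x‖) volume :=
    (integrable_indicator_iff hKm).2 ((hG.integrableOn_isCompact hK).norm.const_mul C)
  refine (h1.comp_snd (volume.restrict (Set.Icc (0 : ℝ) 1))).mono' ?_ ?_
  · exact hG.aestronglyMeasurable.comp_snd.mul
      (Continuous.aestronglyMeasurable (by fun_prop))
  · have h2 : ∀ᵐ a ∂((volume.restrict (Set.Icc (0 : ℝ) 1)).prod (volume : Measure (E n))),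
        a.1 ∈ Set.Icc (0 : ℝ) 1 :=
      Measure.quasiMeasurePreserving_fst.ae (ae_restrict_mem measurableSet_Icc)
    filter_upwards [h2] with a ha
    by_cases hx : a.2 ∈ K
    · rw [Set.indicator_of_mem hx, norm_mul, mul_comm]
      exact mul_le_mul_of_nonneg_right (hC _) (norm_nonneg _)
    · rw [Set.indicator_of_notMem hx]
      have : φ (a.2 + a.1 • h) = 0 := by
        by_contra hne
        refine hx (Metric.mem_cthickening_of_dist_le _ (a.2 + a.1 • h) _ _
          (subset_tsupport φ hne) ?_)
        rw [dist_eq_norm, sub_add_cancel_left, norm_neg, norm_smul, Real.norm_of_nonneg ha.1]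
        exact mul_le_of_le_one_left (norm_nonneg _) ha.2
      simp [this]

theorem measurePreserving_prod_sub_smul (h : E n) :
    MeasurePreserving (fun a : ℝ × E n => (a.1, a.2 - a.1 • h))
      ((volume.restrict (Set.Icc (0 : ℝ) 1)).prod volume)
      ((volume.restrict (Set.Icc (0 : ℝ) 1)).prod volume) := by
  refine (MeasurePreserving.id _).skew_product (g := fun (s : ℝ) (x : E n) => x - s • h)
    (by fun_prop) (ae_of_all _ fun s => (measurePreserving_sub_right volume (s • h)).map_eq)

theorem integrable_prod_translate_mul (hG : LocallyIntegrable G volume)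
    (hφ : Continuous φ) (hφc : HasCompactSupport φ) (h : E n) :
    Integrable (fun a : ℝ × E n => G (a.2 - a.1 • h) * φ a.2)
      ((volume.restrict (Set.Icc (0 : ℝ) 1)).prod volume) := by
  have := (measurePreserving_prod_sub_smul h).integrable_comp_of_integrable
    (integrable_prod_mul_translate hG hφ hφc h)
  simpa [Function.comp_def] using this

theorem integral_mul_translate (h : E n) :
    ∫ x, G x * φ (x + h) = ∫ x, G (x - h) * φ x := by
  simpa using (integral_sub_right_eq_self (fun x => G x * φ (x + h)) h (μ := volume)).symm

theorem integral_segmentAverage_mul (hG : LocallyIntegrable G volume)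
    (hφ : Continuous φ) (hφc : HasCompactSupport φ) (h : E n) :
    ∫ x, segmentAverage G h x * φ x = ∫ s in Set.Icc (0 : ℝ) 1, ∫ x, G x * φ (x + s • h) := by
  simp only [integral_mul_translate, segmentAverage, ← integral_mul_const]
  exact (integral_integral_swap (integrable_prod_translate_mul hG hφ hφc h)).symm

theorem integral_mul_segment (hG : LocallyIntegrable G volume)
    (hφ : Continuous φ) (hφc : HasCompactSupport φ) (h : E n) :
    ∫ x, G x * ∫ s in Set.Icc (0 : ℝ) 1, φ (x + s • h) =
      ∫ s in Set.Icc (0 : ℝ) 1, ∫ x, G x * φ (x + s • h) := by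
  simp only [← integral_const_mul]
  exact (integral_integral_swap (integrable_prod_mul_translate hG hφ hφc h)).symm

theorem sub_eq_sum_integral_partialDeriv (hφ : ContDiff ℝ ∞ φ) (x h : E n) :
    φ (x + h) - φ x = ∑ k, h k * ∫ s in Set.Icc (0 : ℝ) 1, partialDeriv k φ (x + s • h) := by
  have hc : ∀ k, Continuous fun s : ℝ => partialDeriv k φ (x + s • h) := fun k =>
    (contDiff_partialDeriv hφ k).continuous.comp (by fun_prop)
  have hd : ∀ s : ℝ, HasDerivAt (fun s : ℝ => φ (x + s • h))
      (∑ k, h k * partialDeriv k φ (x + s • h)) s := by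
    intro s
    rw [← fderiv_eq_sum_partialDeriv]
    have h1 : HasDerivAt (fun s : ℝ => x + s • h) h s := by
      simpa using ((hasDerivAt_id s).smul_const h).const_add x
    exact ((hφ.differentiable (by simp)).differentiableAt.hasFDerivAt).comp_hasDerivAt s h1
  have h2 := intervalIntegral.integral_eq_sub_of_hasDerivAt (a := 0) (b := 1) (fun s _ => hd s)
    ((continuous_finsetSum _ fun k _ => (hc k).const_mul (h k)).intervalIntegrable _ _)
  simp only [one_smul, zero_smul, add_zero] at h2
  rw [← h2, intervalIntegral.integral_finsetSum
    fun k _ => ((hc k).const_mul (h k)).intervalIntegrable _ _]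
  simp only [integral_const_mul,
    intervalIntegral.integral_of_le zero_le_one, integral_Icc_eq_integral_Ioc]

end Segment

/-- Proved by duality. Against a test function, the increment moves onto `φ`, where the fundamental
theorem of calculus holds; the weak derivative then moves `∂ₖ` back, and Fubini restores the segment
average. -/
theorem ae_sub_translate_eq {u : E n → ℝ} {D : Fin n → E n → ℝ} (hu : StronglyMeasurable u)
    (hui : LocallyIntegrable u volume) (hDm : ∀ k, StronglyMeasurable (D k))
    (hD : ∀ k, HasWeakPartialDeriv k u (D k)) (h : E n) :
    ∀ᵐ x, u x - u (x - h) = ∑ k, h k * segmentAverage (D k) h x := by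
  have hut : LocallyIntegrable (fun x => u (x - h)) volume :=
    memLpLoc_one_iff.1 (memLpLoc_translate hu (memLpLoc_one_iff.2 hui) h)
  have hav : ∀ k, LocallyIntegrable (segmentAverage (D k) h) volume := fun k =>
    memLpLoc_one_iff.1 (memLpLoc_segmentAverage (hDm k) le_rfl (memLpLoc_one_iff.2 (hD k).2.1) h)
  refine ae_eq_of_integral_contDiff_smul_eq (hui.sub hut)
    (locallyIntegrable_finsetSum _ fun k _ => (hav k).smul (h k)) fun φ hφ hφc => ?_
  have hdc : ∀ k, Continuous (partialDeriv k φ) := fun k => (contDiff_partialDeriv hφ k).continuous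
  have hds : ∀ k, HasCompactSupport (partialDeriv k φ) := fun k =>
    hasCompactSupport_partialDeriv hφc k
  have htr : ∀ a : E n, HasCompactSupport fun x => φ (x + a) := fun a =>
    hφc.comp_homeomorph (Homeomorph.addRight a)
  -- Each translate `φ(· + sh)` is again a test function.
  have hweak : ∀ (k : Fin n) (s : ℝ),
      ∫ x, u x * partialDeriv k φ (x + s • h) = -∫ x, D k x * φ (x + s • h) := fun k s => by
    have := (hD k).2.2 _ (hφ.comp (contDiff_id.add contDiff_const)) (htr (s • h))
    simpa only [Function.comp_def, partialDeriv_comp_add_right, id] using this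
  have hint : ∀ k, Integrable
      (fun x => u x * ∫ s in Set.Icc (0 : ℝ) 1, partialDeriv k φ (x + s • h)) volume := fun k => by
    simpa only [integral_const_mul] using
      (integrable_prod_mul_translate hui (hdc k) (hds k) h).integral_prod_right
  have e1 : ∫ x, φ x • (u x - u (x - h)) = -∫ x, u x * (φ (x + h) - φ x) := by
    simp only [smul_eq_mul, mul_comm (φ _), sub_mul, mul_sub]
    rw [integral_sub (integrable_mul_of_hasCompactSupport hui hφ.continuous hφc)
        (integrable_mul_of_hasCompactSupport hut hφ.continuous hφc),
      integral_sub (integrable_mul_of_hasCompactSupport (φ := fun x => φ (x + h)) hui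
        (hφ.continuous.comp (by fun_prop)) (htr h))
        (integrable_mul_of_hasCompactSupport hui hφ.continuous hφc),
      integral_mul_translate]
    ring
  calc ∫ x, φ x • (u x - u (x - h))
      = -∫ x, ∑ k, h k * (u x * ∫ s in Set.Icc (0 : ℝ) 1, partialDeriv k φ (x + s • h)) := by
        simp only [e1, sub_eq_sum_integral_partialDeriv hφ, Finset.mul_sum, mul_left_comm]
    _ = ∑ k, h k * ∫ x, segmentAverage (D k) h x * φ x := by
        rw [integral_finsetSum _ fun k _ => (hint k).const_mul _, ← Finset.sum_neg_distrib]
        refine Finset.sum_congr rfl fun k _ => ?_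
        rw [integral_const_mul, integral_mul_segment hui (hdc k) (hds k),
          integral_segmentAverage_mul (hD k).2.1 hφ.continuous hφc]
        simp only [hweak, integral_neg]
        ring
    _ = ∫ x, φ x • ∑ k, h k * segmentAverage (D k) h x := by
        simp only [smul_eq_mul, Finset.mul_sum]
        rw [integral_finsetSum _ fun k _ => ?_]
        · simp only [← integral_const_mul]
          refine Finset.sum_congr rfl fun k _ => integral_congr_ae (ae_of_all _ fun x => ?_)
          ring
        · convert (integrable_mul_of_hasCompactSupport (hav k) hφ.continuous hφc).const_mul (h k)
            using 2
          ring

/-- The convolution of two real functions. -/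
noncomputable def conv (g F : E n → ℝ) : E n → ℝ :=
  convolution g F (ContinuousLinearMap.mul ℝ ℝ) volume

theorem conv_apply (g F : E n → ℝ) (x : E n) : conv g F x = ∫ t, g t * F (x - t) := rfl

theorem conv_apply_swap (g F : E n → ℝ) (x : E n) : conv g F x = ∫ t, g (x - t) * F t :=
  convolution_mul_swap

/-! ### Convolution with a smooth compactly supported kernel -/

section Smooth

variable {g F : E n → ℝ}

theorem integrable_conv (hg : Continuous g) (hgc : HasCompactSupport g)
    (hF : LocallyIntegrable F volume) (x : E n) : Integrable (fun t => g t * F (x - t)) volume :=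
  hgc.convolutionExists_left (ContinuousLinearMap.mul ℝ ℝ) hg hF x

theorem integrable_conv_swap (hg : Continuous g) (hgc : HasCompactSupport g)
    (hF : LocallyIntegrable F volume) (x : E n) : Integrable (fun t => g (x - t) * F t) volume := by
  simpa using (integrable_conv hg hgc hF x).comp_sub_left x

theorem differentiable_conv (hg : ContDiff ℝ ∞ g) (hgc : HasCompactSupport g)
    (hF : LocallyIntegrable F volume) : Differentiable ℝ (conv g F) := fun x =>
  (hgc.hasFDerivAt_convolution_left (ContinuousLinearMap.mul ℝ ℝ) (hg.of_le (by simp)) hF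
    x).differentiableAt

theorem partialDeriv_conv (hg : ContDiff ℝ ∞ g) (hgc : HasCompactSupport g)
    (hF : LocallyIntegrable F volume) (i : Fin n) :
    partialDeriv i (conv g F) = conv (partialDeriv i g) F := by
  ext x
  have h1 := (hgc.hasFDerivAt_convolution_left (ContinuousLinearMap.mul ℝ ℝ) (hg.of_le (by simp))
    hF x).fderiv
  have h2 : Integrable (fun t => (ContinuousLinearMap.mul ℝ ℝ).precompL (E n) (fderiv ℝ g t)
      (F (x - t))) volume :=
    (hgc.fderiv ℝ).convolutionExists_left _ (hg.continuous_fderiv (by simp)) hF x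
  rw [partialDeriv, conv, h1, convolution_def, ContinuousLinearMap.integral_apply h2]
  simp [conv_apply, partialDeriv]

theorem partialDeriv_comp_sub_left (hg : ContDiff ℝ ∞ g) (i : Fin n) (x y : E n) :
    partialDeriv i (fun y => g (x - y)) y = -partialDeriv i g (x - y) := by
  have h1 : HasFDerivAt (fun y : E n => x - y) (-ContinuousLinearMap.id ℝ (E n)) y := by
    simpa using (hasFDerivAt_id y).const_sub x
  have h2 := (hg.differentiable (by simp)).differentiableAt.hasFDerivAt.comp
    (f := fun y => x - y) y h1
  have h3 : fderiv ℝ (fun y => g (x - y)) y = _ := h2.fderiv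
  rw [partialDeriv, h3]
  simp [partialDeriv]

theorem partialDeriv_partialDeriv_comp_sub_left (hg : ContDiff ℝ ∞ g) (i j : Fin n) (x y : E n) :
    partialDeriv i (partialDeriv j fun y => g (x - y)) y =
      partialDeriv i (partialDeriv j g) (x - y) := by
  have h1 : (partialDeriv j fun y => g (x - y)) = fun y => -partialDeriv j g (x - y) :=
    funext fun y => partialDeriv_comp_sub_left hg j x y
  have h2 := partialDeriv_comp_sub_left (contDiff_partialDeriv hg j) i x y
  rw [h1, partialDeriv, fderiv_fun_neg]
  rw [partialDeriv] at h2
  simp [h2]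

theorem partialDeriv_comm (hg : ContDiff ℝ ∞ g) (i j : Fin n) (x : E n) :
    partialDeriv i (partialDeriv j g) x = partialDeriv j (partialDeriv i g) x := by
  have hd : DifferentiableAt ℝ (fderiv ℝ g) x :=
    ((hg.fderiv_right (m := ∞) (by simp)).differentiable (by simp)).differentiableAt
  have key : ∀ k l : Fin n, partialDeriv k (partialDeriv l g) x =
      fderiv ℝ (fderiv ℝ g) x (EuclideanSpace.single k 1) (EuclideanSpace.single l 1) := by
    intro k l
    have : HasFDerivAt (partialDeriv l g) _ x :=
      hd.hasFDerivAt.clm_apply (hasFDerivAt_const (EuclideanSpace.single l (1 : ℝ)) x)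
    rw [partialDeriv, this.fderiv]
    simp
  rw [key, key]
  exact (hg.contDiffAt.isSymmSndFDerivAt
    (by simpa using ENat.LEInfty.out)) _ _

end Smooth

/-! ### Scaling of the mollifier -/

section Mollifier

variable {η : E n → ℝ} {ε : ℝ}

theorem contDiff_mollifier (hη : ContDiff ℝ ∞ η) (ε : ℝ) : ContDiff ℝ ∞ (mollifier η ε) :=
  contDiff_const.mul (hη.comp (contDiff_const_smul ε⁻¹))

theorem IsMollifierProfile.hasCompactSupport (hη : IsMollifierProfile η) : HasCompactSupport η :=
  HasCompactSupport.of_support_subset_isCompact (isCompact_closedBall 0 1) hη.support_subset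

theorem hasCompactSupport_mollifier (hη : HasCompactSupport η) (hε : ε ≠ 0) :
    HasCompactSupport (mollifier η ε) :=
  HasCompactSupport.mul_left
    (hη.comp_homeomorph (Homeomorph.smulOfNeZero ε⁻¹ (inv_ne_zero hε)))

theorem partialDeriv_mul_comp_smul {g : E n → ℝ} (c : ℝ) (i : Fin n) (t : E n) (a : ℝ) :
    partialDeriv i (fun x => a * g (c • x)) t = a * c * partialDeriv i g (c • t) := by
  have : fderiv ℝ (fun x => a * g (c • x)) t = a • c • fderiv ℝ g (c • t) := by
    rw [← fderiv_comp_smul]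
    exact congrFun (fderiv_const_smul_field (𝕜 := ℝ) (f := fun x => g (c • x)) a) t
  simp [partialDeriv, this, mul_assoc]

theorem partialDeriv_mollifier (η : E n → ℝ) (ε : ℝ) (i : Fin n) :
    partialDeriv i (mollifier η ε) = fun t => (ε ^ n)⁻¹ * ε⁻¹ * partialDeriv i η (ε⁻¹ • t) :=
  funext fun t => partialDeriv_mul_comp_smul _ i t _

theorem partialDeriv_partialDeriv_mollifier (η : E n → ℝ) (ε : ℝ) (i j : Fin n) :
    partialDeriv i (partialDeriv j (mollifier η ε)) =
      fun t => (ε ^ n)⁻¹ * ε⁻¹ * ε⁻¹ * partialDeriv i (partialDeriv j η) (ε⁻¹ • t) := by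
  rw [partialDeriv_mollifier]
  exact funext fun t => partialDeriv_mul_comp_smul _ i t _

theorem support_partialDeriv_subset {g : E n → ℝ}
    (hg : Function.support g ⊆ Metric.closedBall 0 1) (i : Fin n) :
    Function.support (partialDeriv i g) ⊆ Metric.closedBall 0 1 := by
  intro x hx
  have h1 : tsupport g ⊆ Metric.closedBall 0 1 := closure_minimal hg Metric.isClosed_closedBall
  exact h1 (support_fderiv_subset ℝ fun h => hx (by simp [partialDeriv, h]))

/-- The substitution `t = εz`, whose Jacobian absorbs `ε⁻ⁿ`. The constant `c` carries the `ε⁻¹` or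
`ε⁻²` produced by differentiating the mollifier. -/
theorem integral_scaled {ψ Q : E n → ℝ} (hψ : Function.support ψ ⊆ Metric.closedBall 0 1)
    (hε : 0 < ε) (c : ℝ) :
    ∫ t, (ε ^ n)⁻¹ * c * ψ (ε⁻¹ • t) * Q t =
      ∫ z in Metric.closedBall (0 : E n) 1, c * ψ z * Q (ε • z) := by
  have h1 := Measure.integral_comp_smul_of_nonneg (volume : Measure (E n))
    (fun t => c * ψ (ε⁻¹ • t) * Q t) ε (hR := hε.le)
  simp only [finrank_euclideanSpace, Fintype.card_fin, inv_smul_smul₀ hε.ne', smul_eq_mul] at h1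
  rw [setIntegral_eq_integral_of_forall_compl_eq_zero, h1, ← integral_const_mul]
  · simp only [mul_assoc]
  · intro z hz
    have : ψ z = 0 := by
      by_contra h
      exact hz (hψ h)
    simp [this]

end Mollifier

/-! ### Commutators as integrals of increments -/

section Kernel

variable {η : E n → ℝ} {ε : ℝ} {σ : E n → E n} {f : E n → ℝ}

/-- The sign in the distributional divergence cancels the one from differentiating `η_ε(x - y)` in
`y`. -/
theorem mollifyDistribution_divDistribution (hη : IsMollifierProfile η) (hε : ε ≠ 0)
    (hfσ : ∀ i, LocallyIntegrable (fun y => f y * σ y i) volume) :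
    mollifyDistribution η ε (divDistribution σ f) =
      fun x => ∑ i, conv (partialDeriv i (mollifier η ε)) (fun y => f y * σ y i) x := by
  ext x
  have hg := contDiff_mollifier hη.contDiff ε
  have hgc := hasCompactSupport_mollifier hη.hasCompactSupport hε
  simp only [conv_apply_swap]
  rw [← integral_finsetSum _ fun i _ => integrable_conv_swap
    (contDiff_partialDeriv hg i).continuous (hasCompactSupport_partialDeriv hgc i) (hfσ i) x]
  simp only [mollifyDistribution, divDistribution, gradAlong, ← integral_neg,
    partialDeriv_comp_sub_left hg, Finset.mul_sum, ← Finset.sum_neg_distrib]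
  refine integral_congr_ae (ae_of_all _ fun y => Finset.sum_congr rfl fun i _ => ?_)
  ring

theorem mollifyDistribution_adjointDistribution (hη : IsMollifierProfile η) (hε : ε ≠ 0)
    (hfσσ : ∀ i j, LocallyIntegrable (fun y => f y * σ y i * σ y j) volume) :
    mollifyDistribution η ε (adjointDistribution σ f) =
      fun x => (1 / 2) * ∑ i, ∑ j, conv (partialDeriv i (partialDeriv j (mollifier η ε)))
        (fun y => f y * σ y i * σ y j) x := by
  ext x
  have hg := contDiff_mollifier hη.contDiff ε
  have hgc := hasCompactSupport_mollifier hη.hasCompactSupport hε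
  have hint := fun i j => integrable_conv_swap
    (contDiff_partialDeriv (contDiff_partialDeriv hg j) i).continuous
    (hasCompactSupport_partialDeriv (hasCompactSupport_partialDeriv hgc j) i) (hfσσ i j) x
  simp only [conv_apply_swap]
  simp_rw [← integral_finsetSum _ fun j _ => hint _ j]
  rw [← integral_finsetSum _ fun i _ => integrable_finsetSum _ fun j _ => hint i j,
    ← integral_const_mul]
  simp only [mollifyDistribution, adjointDistribution, secondAlong,
    partialDeriv_partialDeriv_comp_sub_left hg, Finset.mul_sum]
  refine integral_congr_ae (ae_of_all _ fun y => Finset.sum_congr rfl fun i _ =>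
    Finset.sum_congr rfl fun j _ => ?_)
  ring

theorem T_eq_sum_integral (hη : IsMollifierProfile η) (hε : 0 < ε)
    (hf : LocallyIntegrable f volume)
    (hfσ : ∀ i, LocallyIntegrable (fun y => f y * σ y i) volume) (x : E n) :
    T η σ ε f x = ∑ i, ∫ z in Metric.closedBall (0 : E n) 1,
      ε⁻¹ * partialDeriv i η z * (f (x - ε • z) * (σ x i - σ (x - ε • z) i)) := by
  have hg := contDiff_mollifier hη.contDiff ε
  have hgc := hasCompactSupport_mollifier hη.hasCompactSupport hε.ne'
  have hm : mollify η ε f = conv (mollifier η ε) f := rfl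
  rw [T, mollifyDistribution_divDistribution hη hε.ne' hfσ, gradAlong, ← Finset.sum_sub_distrib]
  refine Finset.sum_congr rfl fun i _ => ?_
  have hc := (contDiff_partialDeriv hg i).continuous
  have hs := hasCompactSupport_partialDeriv hgc i
  rw [hm, partialDeriv_conv hg hgc hf, conv_apply, conv_apply, ← integral_const_mul,
    ← integral_sub ((integrable_conv hc hs hf x).const_mul _) (integrable_conv hc hs (hfσ i) x),
    ← integral_scaled (Q := fun t => f (x - t) * (σ x i - σ (x - t) i))
      (support_partialDeriv_subset hη.support_subset i) hε, partialDeriv_mollifier]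
  refine integral_congr_ae (ae_of_all _ fun t => ?_)
  ring

/-- The four terms are those of the expanded product `(σᵢ(x) - σᵢ(y))(σⱼ(x) - σⱼ(y))`. The middle
term of `S` has no factor `½`, so it supplies both mixed terms. -/
theorem S_eq_sum_conv (hη : IsMollifierProfile η) (hε : 0 < ε)
    (hf : LocallyIntegrable f volume)
    (hfσ : ∀ i, LocallyIntegrable (fun y => f y * σ y i) volume)
    (hfσσ : ∀ i j, LocallyIntegrable (fun y => f y * σ y i * σ y j) volume) (x : E n) :
    S η σ ε f x = (1 / 2) * ∑ i, ∑ j,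
      (σ x i * σ x j * conv (partialDeriv i (partialDeriv j (mollifier η ε))) f x
        - σ x i * conv (partialDeriv i (partialDeriv j (mollifier η ε))) (fun y => f y * σ y j) x
        - σ x j * conv (partialDeriv i (partialDeriv j (mollifier η ε))) (fun y => f y * σ y i) x
        + conv (partialDeriv i (partialDeriv j (mollifier η ε)))
          (fun y => f y * σ y i * σ y j) x) := by
  have hg := contDiff_mollifier hη.contDiff ε
  have hgc := hasCompactSupport_mollifier hη.hasCompactSupport hε.ne'
  have hm : mollify η ε f = conv (mollifier η ε) f := rfl
  have hd : ∀ i j, partialDeriv i (fun x => conv (partialDeriv j (mollifier η ε))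
      (fun y => f y * σ y j) x) = conv (partialDeriv i (partialDeriv j (mollifier η ε)))
      (fun y => f y * σ y j) := fun i j =>
    partialDeriv_conv (contDiff_partialDeriv hg j) (hasCompactSupport_partialDeriv hgc j) (hfσ j) i
  have hsum : ∀ i, partialDeriv i (fun x => ∑ j, conv (partialDeriv j (mollifier η ε))
      (fun y => f y * σ y j) x) x = ∑ j, conv (partialDeriv i (partialDeriv j (mollifier η ε)))
      (fun y => f y * σ y j) x := by
    intro i
    rw [partialDeriv, fderiv_fun_sum fun j _ => (differentiable_conv (contDiff_partialDeriv hg j)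
      (hasCompactSupport_partialDeriv hgc j) (hfσ j)).differentiableAt]
    simp only [sum_apply]
    exact Finset.sum_congr rfl fun j _ => congrFun (hd i j) x
  have hcomm : ∀ i j, partialDeriv i (partialDeriv j (mollifier η ε)) =
      partialDeriv j (partialDeriv i (mollifier η ε)) := fun i j =>
    funext fun t => partialDeriv_comm hg i j t
  -- Symmetry of the second derivatives makes the two mixed sums equal.
  have hswap : ∑ i, ∑ j, σ x j * conv (partialDeriv i (partialDeriv j (mollifier η ε)))
      (fun y => f y * σ y i) x = ∑ i, ∑ j, σ x i *
      conv (partialDeriv i (partialDeriv j (mollifier η ε))) (fun y => f y * σ y j) x := by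
    rw [Finset.sum_comm]
    refine Finset.sum_congr rfl fun i _ => Finset.sum_congr rfl fun j _ => ?_
    rw [hcomm]
  rw [S, mollifyDistribution_divDistribution hη hε.ne' hfσ,
    mollifyDistribution_adjointDistribution hη hε.ne' hfσσ]
  simp only [secondAlong, gradAlong, hsum, hm, partialDeriv_conv hg hgc hf,
    partialDeriv_conv (contDiff_partialDeriv hg _) (hasCompactSupport_partialDeriv hgc _) hf,
    Finset.sum_add_distrib, Finset.sum_sub_distrib, hswap, Finset.mul_sum]
  simp only [← Finset.mul_sum]
  ring

theorem S_eq_sum_integral (hη : IsMollifierProfile η) (hε : 0 < ε)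
    (hf : LocallyIntegrable f volume)
    (hfσ : ∀ i, LocallyIntegrable (fun y => f y * σ y i) volume)
    (hfσσ : ∀ i j, LocallyIntegrable (fun y => f y * σ y i * σ y j) volume) (x : E n) :
    S η σ ε f x = (1 / 2) * ∑ i, ∑ j, ∫ z in Metric.closedBall (0 : E n) 1,
      ε⁻¹ * ε⁻¹ * partialDeriv i (partialDeriv j η) z *
        (f (x - ε • z) * (σ x i - σ (x - ε • z) i) * (σ x j - σ (x - ε • z) j)) := by
  have hg := contDiff_mollifier hη.contDiff ε
  have hgc := hasCompactSupport_mollifier hη.hasCompactSupport hε.ne'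
  rw [S_eq_sum_conv hη hε hf hfσ hfσσ]
  congr 1
  refine Finset.sum_congr rfl fun i _ => Finset.sum_congr rfl fun j _ => ?_
  have hc := (contDiff_partialDeriv (contDiff_partialDeriv hg j) i).continuous
  have hs := hasCompactSupport_partialDeriv (hasCompactSupport_partialDeriv hgc j) i
  have i1 := (integrable_conv hc hs hf x).const_mul (σ x i * σ x j)
  have i2 := (integrable_conv hc hs (hfσ j) x).const_mul (σ x i)
  have i3 := (integrable_conv hc hs (hfσ i) x).const_mul (σ x j)
  have i4 := integrable_conv hc hs (hfσσ i j) x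
  simp only [conv_apply, ← integral_const_mul]
  have i12 := i1.sub i2
  simp only [Pi.sub_def] at i12
  have i123 := i12.sub i3
  simp only [Pi.sub_def] at i123
  rw [← integral_sub i1 i2, ← integral_sub i12 i3, ← integral_add i123 i4,
    ← integral_scaled
      (Q := fun t => f (x - t) * (σ x i - σ (x - t) i) * (σ x j - σ (x - t) j))
      (support_partialDeriv_subset (support_partialDeriv_subset hη.support_subset j) i) hε,
    partialDeriv_partialDeriv_mollifier]
  refine integral_congr_ae (ae_of_all _ fun t => ?_)
  ring

end Kernel

/-! ### Moments of the derivatives of the profile -/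

section Moments

variable {η : E n → ℝ}

theorem partialDeriv_coord (i k : Fin n) (z : E n) :
    partialDeriv i (fun z : E n => z k) z = if k = i then 1 else 0 := by
  have : HasFDerivAt (fun z : E n => z k) (EuclideanSpace.proj k : E n →L[ℝ] ℝ) z :=
    (EuclideanSpace.proj k : E n →L[ℝ] ℝ).hasFDerivAt
  rw [partialDeriv, this.fderiv]
  simp

theorem integral_mul_partialDeriv {g ψ : E n → ℝ} (hg : ContDiff ℝ ∞ g) (hψ : ContDiff ℝ ∞ ψ)
    (hψc : HasCompactSupport ψ) (i : Fin n) :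
    ∫ z, g z * partialDeriv i ψ z = -∫ z, partialDeriv i g z * ψ z :=
  integral_mul_fderiv_eq_neg_fderiv_mul_of_integrable
    (((contDiff_partialDeriv hg i).continuous.mul hψ.continuous).integrable_of_hasCompactSupport
      hψc.mul_left)
    ((hg.continuous.mul (contDiff_partialDeriv hψ i).continuous).integrable_of_hasCompactSupport
      (hasCompactSupport_partialDeriv hψc i).mul_left)
    ((hg.continuous.mul hψ.continuous).integrable_of_hasCompactSupport hψc.mul_left)
    (fun _ _ => (hg.differentiable (by simp)).differentiableAt)
    (fun _ _ => (hψ.differentiable (by simp)).differentiableAt)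

theorem contDiff_coord (k : Fin n) : ContDiff ℝ ∞ fun z : E n => z k :=
  (EuclideanSpace.proj k : E n →L[ℝ] ℝ).contDiff

theorem integral_coord_mul_partialDeriv (hη : IsMollifierProfile η) (i k : Fin n) :
    ∫ z, z k * partialDeriv i η z = if k = i then -1 else 0 := by
  rw [integral_mul_partialDeriv (contDiff_coord k) hη.contDiff hη.hasCompactSupport]
  simp only [partialDeriv_coord]
  split_ifs <;> simp [hη.integral_eq_one]

/-- One integration by parts and the product rule leave first moments of `∂ⱼη`; the two minus signs
cancel. -/
theorem integral_coord_mul_coord_mul_partialDeriv (hη : IsMollifierProfile η) (i j k l : Fin n) :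
    ∫ z, z k * z l * partialDeriv i (partialDeriv j η) z =
      (if k = i then 1 else 0) * (if l = j then 1 else 0) +
        (if l = i then 1 else 0) * (if k = j then 1 else 0) := by
  have hd : ∀ z : E n, partialDeriv i (fun z : E n => z k * z l) z =
      (if k = i then 1 else 0) * z l + (if l = i then 1 else 0) * z k := by
    intro z
    have h1 := ((contDiff_coord k).differentiable (by simp)).differentiableAt (x := z)
    have h2 := ((contDiff_coord l).differentiable (by simp)).differentiableAt (x := z)
    have e1 := partialDeriv_coord i k z
    have e2 := partialDeriv_coord i l z
    rw [partialDeriv] at e1 e2 ⊢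
    rw [fderiv_fun_mul h1 h2]
    simp only [add_apply, smul_apply, e1, e2, smul_eq_mul]
    ring
  have hint : ∀ m : Fin n, Integrable (fun z => z m * partialDeriv j η z) volume := fun m =>
    ((contDiff_coord m).continuous.mul
      (contDiff_partialDeriv hη.contDiff j).continuous).integrable_of_hasCompactSupport
      (hasCompactSupport_partialDeriv hη.hasCompactSupport j).mul_left
  rw [integral_mul_partialDeriv ((contDiff_coord k).mul (contDiff_coord l))
    (contDiff_partialDeriv hη.contDiff j) (hasCompactSupport_partialDeriv hη.hasCompactSupport j)]
  simp only [hd, add_mul, mul_assoc]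
  rw [integral_add ((hint l).const_mul _) ((hint k).const_mul _), integral_const_mul,
    integral_const_mul, integral_coord_mul_partialDeriv hη, integral_coord_mul_partialDeriv hη]
  split_ifs <;> simp

end Moments

/-- `U ε` is a finite sum of weighted averages of the functions `P a (ε z)`, which converge to
`P₀ a`; `U₀` is the expected limit and `B K ε` bounds the `L^r(K)` norms. -/
structure KernelRepresentation {A : Type*} [Fintype A] (w : A → E n → ℝ) (U : ℝ → E n → ℝ)
    (U₀ : E n → ℝ) (r : ℝ≥0∞) (B : Set (E n) → ℝ → ℝ≥0∞) (P : A → E n → E n → ℝ)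
    (P₀ : A → E n → ℝ) : Prop where
  meas : ∀ a, StronglyMeasurable (Function.uncurry (P a))
  meas_lim : ∀ a, StronglyMeasurable (P₀ a)
  bound_lt_top : ∀ K, IsCompact K → ∀ ε : ℝ, B K ε < ⊤
  bound : ∀ K, IsCompact K → ∀ ε : ℝ, ∀ a h, ‖h‖ ≤ ε →
    eLpNorm (P a h) r (volume.restrict K) ≤ B K ε
  tendsto : ∀ K, IsCompact K → ∀ a, BddTendsto (𝓝 0) (P a) (P₀ a) r (volume.restrict K)
  ae_eq : ∀ K, IsCompact K → ∀ ε : ℝ, 0 < ε →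
    U ε =ᵐ[volume.restrict K] fun x => ∑ a, kernelAverage (w a) (P a) ε x
  ae_eq_lim : U₀ =ᵐ[volume] fun x => ∑ a, (∫ z in Metric.closedBall (0 : E n) 1, w a z) * P₀ a x

/-! ### Bounds and limits from a kernel representation -/

namespace KernelRepresentation

variable {A : Type*} [Fintype A] {w : A → E n → ℝ} {U : ℝ → E n → ℝ} {U₀ : E n → ℝ} {r : ℝ≥0∞}
  {B : Set (E n) → ℝ → ℝ≥0∞} {P : A → E n → E n → ℝ} {P₀ : A → E n → ℝ}

theorem eLpNorm_le (H : KernelRepresentation w U U₀ r B P P₀) (hw : ∀ a, Continuous (w a))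
    {W : A → ℝ≥0} (hW : ∀ a z, ‖w a z‖ ≤ W a) (hr : 1 ≤ r) {K : Set (E n)} (hK : IsCompact K)
    {ε : ℝ} (hε : 0 < ε) :
    eLpNorm (U ε) r (volume.restrict K) ≤
      volume (Metric.closedBall (0 : E n) 1) * ((∑ a, W a : ℝ≥0) : ℝ≥0∞) * B K ε := by
  have hm : ∀ a, AEStronglyMeasurable (kernelAverage (w a) (P a) ε) (volume.restrict K) :=
    fun a => (stronglyMeasurable_kernelAverage (hw a) (H.meas a) ε).aestronglyMeasurable
  rw [eLpNorm_congr_ae (H.ae_eq K hK ε hε)]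
  calc eLpNorm (fun x => ∑ a, kernelAverage (w a) (P a) ε x) r (volume.restrict K)
      = eLpNorm (∑ a, kernelAverage (w a) (P a) ε) r (volume.restrict K) := by
        congr 1; ext x; simp
    _ ≤ ∑ a, eLpNorm (kernelAverage (w a) (P a) ε) r (volume.restrict K) :=
        eLpNorm_sum_le (fun a _ => hm a) hr
    _ ≤ ∑ a, volume (Metric.closedBall (0 : E n) 1) * (W a * B K ε) :=
        Finset.sum_le_sum fun a _ =>
          eLpNorm_kernelAverage_le (hw a) (hW a) (H.meas a) hr hε (H.bound K hK ε a)
    _ = _ := by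
        push_cast
        rw [← Finset.mul_sum, ← Finset.sum_mul, mul_assoc]

theorem memLp (H : KernelRepresentation w U U₀ r B P P₀) (hw : ∀ a, Continuous (w a))
    {W : A → ℝ≥0} (hW : ∀ a z, ‖w a z‖ ≤ W a) (hr : 1 ≤ r) {K : Set (E n)} (hK : IsCompact K)
    {ε : ℝ} (hε : 0 < ε) : MemLp (U ε) r (volume.restrict K) := by
  refine ⟨AEStronglyMeasurable.congr ?_ (H.ae_eq K hK ε hε).symm,
    (H.eLpNorm_le hw hW hr hK hε).trans_lt (ENNReal.mul_lt_top
      (ENNReal.mul_lt_top measure_closedBall_lt_top ENNReal.coe_lt_top) (H.bound_lt_top K hK ε))⟩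
  exact Finset.aestronglyMeasurable_fun_sum _ fun a _ =>
    (stronglyMeasurable_kernelAverage (hw a) (H.meas a) ε).aestronglyMeasurable

theorem tendstoLpLoc (H : KernelRepresentation w U U₀ r B P P₀) (hw : ∀ a, Continuous (w a))
    {W : A → ℝ≥0} (hW : ∀ a z, ‖w a z‖ ≤ W a) (hr : 1 ≤ r) (hr' : r ≠ ⊤) :
    TendstoLpLoc U U₀ r := by
  refine ⟨fun ε hε K hK => H.memLp hw hW hr hK hε, fun K hK => ?_, fun K hK => ?_⟩
  · refine MemLp.ae_eq (Filter.EventuallyEq.symm (ae_restrict_of_ae H.ae_eq_lim)) ?_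
    exact memLp_finsetSum _ fun a _ => (H.tendsto K hK a).memLp.const_mul _
  · have h1 := tendsto_finsetSum Finset.univ fun a _ =>
      tendsto_kernelAverage (hw a) (hW a) (H.meas a) (H.meas_lim a) hr hr' (H.tendsto K hK a)
    rw [Finset.sum_const_zero] at h1
    refine tendsto_of_tendsto_of_tendsto_of_le_of_le' tendsto_const_nhds h1
      (Eventually.of_forall fun _ => zero_le) ?_
    filter_upwards [self_mem_nhdsWithin] with ε hε
    calc eLpNorm (fun x => U ε x - U₀ x) r (volume.restrict K)
        = eLpNorm (∑ a, fun x => kernelAverage (w a) (P a) ε x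
            - (∫ z in Metric.closedBall (0 : E n) 1, w a z) * P₀ a x) r (volume.restrict K) := by
          refine eLpNorm_congr_ae ?_
          filter_upwards [H.ae_eq K hK ε hε, ae_restrict_of_ae H.ae_eq_lim] with x hx hx0
          simp [hx, hx0, Finset.sum_sub_distrib]
      _ ≤ _ := eLpNorm_sum_le (fun a _ =>
          ((stronglyMeasurable_kernelAverage (hw a) (H.meas a) ε).sub
            ((H.meas_lim a).const_mul _)).aestronglyMeasurable) hr

end KernelRepresentation

/-! ### Comparison of matrix entries with the Frobenius norm -/

section GradNorm

variable {D : Fin n → Fin n → E n → ℝ}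

theorem abs_le_gradNorm (D : Fin n → Fin n → E n → ℝ) (i j : Fin n) (x : E n) :
    |D i j x| ≤ gradNorm D x := by
  refine Real.abs_le_sqrt ?_
  calc D i j x ^ 2 ≤ ∑ j, D i j x ^ 2 :=
        Finset.single_le_sum (f := fun j => D i j x ^ 2) (fun _ _ => sq_nonneg _)
          (Finset.mem_univ j)
    _ ≤ _ := Finset.single_le_sum (f := fun i => ∑ j, D i j x ^ 2)
        (fun _ _ => Finset.sum_nonneg fun _ _ => sq_nonneg _) (Finset.mem_univ i)

theorem gradNorm_le_sum (D : Fin n → Fin n → E n → ℝ) (x : E n) :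
    gradNorm D x ≤ ∑ a : Fin n × Fin n, |D a.1 a.2 x| := by
  rw [gradNorm, ← Fintype.sum_prod_type' (f := fun i j => D i j x ^ 2)]
  refine Real.sqrt_le_iff.2 ⟨Finset.sum_nonneg fun _ _ => abs_nonneg _, ?_⟩
  simpa using Finset.sum_sq_le_sq_sum_of_nonneg (s := Finset.univ)
    (f := fun a : Fin n × Fin n => |D a.1 a.2 x|) fun _ _ => abs_nonneg _

theorem memLp_gradNorm {q : ℝ≥0∞} {μ : Measure (E n)} (hD : ∀ i j, MemLp (D i j) q μ) :
    MemLp (gradNorm D) q μ := by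
  have h1 : MemLp (fun x => ∑ a : Fin n × Fin n, |D a.1 a.2 x|) q μ :=
    memLp_finsetSum _ fun a _ => (hD a.1 a.2).abs
  refine h1.mono ?_ (ae_of_all _ fun x => ?_)
  · have : AEMeasurable (gradNorm D) μ := by
      refine AEMeasurable.sqrt ?_
      exact Finset.aemeasurable_fun_sum _ fun i _ => Finset.aemeasurable_fun_sum _ fun j _ =>
        (hD i j).1.aemeasurable.pow_const 2
    exact this.aestronglyMeasurable
  · rw [Real.norm_of_nonneg (show 0 ≤ gradNorm D x from Real.sqrt_nonneg _),
      Real.norm_of_nonneg (Finset.sum_nonneg fun _ _ => abs_nonneg _)]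
    exact gradNorm_le_sum D x

theorem eLpNorm_le_gradNorm (D : Fin n → Fin n → E n → ℝ) (i j : Fin n) (q : ℝ≥0∞)
    (μ : Measure (E n)) : eLpNorm (D i j) q μ ≤ eLpNorm (gradNorm D) q μ :=
  eLpNorm_mono_real fun x => abs_le_gradNorm D i j x

end GradNorm

/-! ### Hölder bounds for the integrands -/

section Products

variable {f : E n → ℝ} {D D' : E n → ℝ} {p q r s : ℝ≥0∞}

theorem stronglyMeasurable_translate (hf : StronglyMeasurable f) :
    StronglyMeasurable (Function.uncurry fun h x => f (x - h)) :=
  hf.comp_measurable (by fun_prop)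

theorem eLpNorm_translate_mul_segmentAverage_le [ENNReal.HolderTriple p q r]
    (hf : StronglyMeasurable f) (hD : StronglyMeasurable D) (hq : 1 ≤ q) {K : Set (E n)} {ε : ℝ}
    {h : E n} (hh : ‖h‖ ≤ ε) :
    eLpNorm (fun x => f (x - h) * segmentAverage D h x) r (volume.restrict K) ≤
      eLpNorm f p (volume.restrict (Metric.cthickening ε K)) *
        eLpNorm D q (volume.restrict (Metric.cthickening ε K)) :=
  (eLpNorm_mul_le_mul
    ((stronglyMeasurable_translate hf).comp_measurable measurable_prodMk_left).aestronglyMeasurable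
    ((stronglyMeasurable_segmentAverage hD).comp_measurable
      measurable_prodMk_left).aestronglyMeasurable).trans
    (mul_le_mul' (eLpNorm_translate_le hf p K hh) (eLpNorm_segmentAverage_le hD hq K hh))

theorem eLpNorm_translate_mul_segmentAverage_mul_le [ENNReal.HolderTriple q q s]
    [ENNReal.HolderTriple p s r] (hf : StronglyMeasurable f) (hD : StronglyMeasurable D)
    (hD' : StronglyMeasurable D') (hq : 1 ≤ q) {K : Set (E n)} {ε : ℝ} {h : E n} (hh : ‖h‖ ≤ ε) :
    eLpNorm (fun x => f (x - h) * (segmentAverage D h x * segmentAverage D' h x)) r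
        (volume.restrict K) ≤
      eLpNorm f p (volume.restrict (Metric.cthickening ε K)) *
        (eLpNorm D q (volume.restrict (Metric.cthickening ε K)) *
          eLpNorm D' q (volume.restrict (Metric.cthickening ε K))) := by
  have m0 := ((stronglyMeasurable_translate hf).comp_measurable
    (measurable_prodMk_left (x := h))).aestronglyMeasurable (μ := volume.restrict K)
  have m1 := ((stronglyMeasurable_segmentAverage hD).comp_measurable
    (measurable_prodMk_left (x := h))).aestronglyMeasurable (μ := volume.restrict K)
  have m2 := ((stronglyMeasurable_segmentAverage hD').comp_measurable
    (measurable_prodMk_left (x := h))).aestronglyMeasurable (μ := volume.restrict K)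
  exact (eLpNorm_mul_le_mul (p := p) (q := s) m0 (m1.mul m2)).trans
    (mul_le_mul' (eLpNorm_translate_le hf p K hh) ((eLpNorm_mul_le_mul (p := q) (q := q)
      m1 m2).trans (mul_le_mul' (eLpNorm_segmentAverage_le hD hq K hh)
        (eLpNorm_segmentAverage_le hD' hq K hh))))

theorem MemLpLoc.mul [ENNReal.HolderTriple p q r] {g : E n → ℝ} (hf : MemLpLoc f p)
    (hg : MemLpLoc g q) : MemLpLoc (fun x => f x * g x) r := fun K hK =>
  (hg K hK).mul' (hf K hK)

end Products

/-- The weights in the kernel representation of `T`. -/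
noncomputable def weightT (η : E n → ℝ) (a : Fin n × Fin n) (z : E n) : ℝ :=
  z a.2 * partialDeriv a.1 η z

/-- The weights in the kernel representation of `S`. -/
noncomputable def weightS (η : E n → ℝ) (a : (Fin n × Fin n) × (Fin n × Fin n)) (z : E n) : ℝ :=
  (1 / 2) * (z a.2.1 * z a.2.2 * partialDeriv a.1.1 (partialDeriv a.1.2 η) z)

/-! ### Bounds and integrals of the weights -/

section Weights

variable {η : E n → ℝ}

theorem continuous_weightT (hη : IsMollifierProfile η) (a : Fin n × Fin n) :
    Continuous (weightT η a) :=
  (contDiff_coord a.2).continuous.mul (contDiff_partialDeriv hη.contDiff a.1).continuous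

theorem continuous_weightS (hη : IsMollifierProfile η) (a : (Fin n × Fin n) × (Fin n × Fin n)) :
    Continuous (weightS η a) :=
  (((contDiff_coord a.2.1).continuous.mul (contDiff_coord a.2.2).continuous).mul
    (contDiff_partialDeriv (contDiff_partialDeriv hη.contDiff a.1.2) a.1.1).continuous).const_mul _

theorem support_weightT (hη : IsMollifierProfile η) (a : Fin n × Fin n) :
    Function.support (weightT η a) ⊆ Metric.closedBall 0 1 :=
  (Function.support_mul_subset_right _ _).trans (support_partialDeriv_subset hη.support_subset a.1)

theorem support_weightS (hη : IsMollifierProfile η) (a : (Fin n × Fin n) × (Fin n × Fin n)) :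
    Function.support (weightS η a) ⊆ Metric.closedBall 0 1 :=
  (Function.support_mul_subset_right _ _).trans ((Function.support_mul_subset_right _ _).trans
    (support_partialDeriv_subset (support_partialDeriv_subset hη.support_subset a.1.2) a.1.1))

theorem exists_norm_le {A : Type*} {w : A → E n → ℝ} (hw : ∀ a, Continuous (w a))
    (hs : ∀ a, Function.support (w a) ⊆ Metric.closedBall 0 1) :
    ∃ W : A → ℝ≥0, ∀ a z, ‖w a z‖ ≤ W a := by
  have h : ∀ a, ∃ C : ℝ≥0, ∀ z, ‖w a z‖ ≤ C := fun a => by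
    obtain ⟨C, hC⟩ := (hw a).bounded_above_of_compact_support
      (HasCompactSupport.of_support_subset_isCompact (isCompact_closedBall 0 1) (hs a))
    exact ⟨⟨C, (norm_nonneg _).trans (hC 0)⟩, hC⟩
  choose W hW using h
  exact ⟨W, hW⟩

theorem setIntegral_closedBall_eq {w : E n → ℝ}
    (hs : Function.support w ⊆ Metric.closedBall 0 1) :
    ∫ z in Metric.closedBall (0 : E n) 1, w z = ∫ z, w z :=
  setIntegral_eq_integral_of_forall_compl_eq_zero fun z hz => by
    by_contra h
    exact hz (hs h)

theorem setIntegral_weightT (hη : IsMollifierProfile η) (a : Fin n × Fin n) :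
    ∫ z in Metric.closedBall (0 : E n) 1, weightT η a z = if a.2 = a.1 then -1 else 0 :=
  (setIntegral_closedBall_eq (support_weightT hη a)).trans
    (integral_coord_mul_partialDeriv hη a.1 a.2)

theorem setIntegral_weightS (hη : IsMollifierProfile η) (a : (Fin n × Fin n) × (Fin n × Fin n)) :
    ∫ z in Metric.closedBall (0 : E n) 1, weightS η a z =
      (1 / 2) * ((if a.2.1 = a.1.1 then 1 else 0) * (if a.2.2 = a.1.2 then 1 else 0) +
        (if a.2.2 = a.1.1 then 1 else 0) * (if a.2.1 = a.1.2 then 1 else 0)) := by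
  rw [setIntegral_closedBall_eq (support_weightS hη a)]
  simp only [weightS]
  rw [integral_const_mul, integral_coord_mul_coord_mul_partialDeriv hη]

end Weights

/-! ### Kernel representations for measurable representatives -/

section Representation

variable {η : E n → ℝ} {f : E n → ℝ} {σ : E n → E n} {D : Fin n → Fin n → E n → ℝ}
  {p q r : ℝ≥0∞}

theorem MemLpLoc.coord (hσ : MemLpLoc σ q) (i : Fin n) : MemLpLoc (fun x => σ x i) q :=
  fun K hK => (EuclideanSpace.proj i : E n →L[ℝ] ℝ).comp_memLp' (hσ K hK)

/-- The segment formula holds for each `z` outside a null set of `x` depending on `z`. Fubini for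
null sets exchanges the quantifiers; it needs a jointly measurable set, hence strongly measurable
representatives. -/
theorem ae_ae_sub_eq (hσm : StronglyMeasurable σ) (hDm : ∀ i j, StronglyMeasurable (D i j))
    (hσ : MemW1Loc σ D q) (ε : ℝ) :
    ∀ᵐ x, ∀ᵐ z ∂(volume.restrict (Metric.closedBall (0 : E n) 1)), ∀ i,
      σ x i - σ (x - ε • z) i = ε * ∑ k, z k * segmentAverage (D k i) (ε • z) x := by
  have hσi : ∀ i, StronglyMeasurable fun x => σ x i := fun i =>
    (EuclideanSpace.proj i : E n →L[ℝ] ℝ).continuous.comp_stronglyMeasurable hσm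
  have key : ∀ i, ∀ᵐ x, ∀ᵐ z ∂(volume.restrict (Metric.closedBall (0 : E n) 1)),
      σ x i - σ (x - ε • z) i = ε * ∑ k, z k * segmentAverage (D k i) (ε • z) x := by
    intro i
    refine (Measure.ae_ae_comm (p := fun x z => σ x i - σ (x - ε • z) i =
      ε * ∑ k, z k * segmentAverage (D k i) (ε • z) x) ?_).2 (ae_of_all _ fun z => ?_)
    · refine measurableSet_eq_fun ?_ ?_
      · exact ((hσi i).measurable.comp measurable_fst).sub ((hσi i).measurable.comp (by fun_prop))
      · refine Measurable.const_mul (Finset.measurable_fun_sum _ fun k _ => Measurable.mul ?_ ?_) _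
        · exact (contDiff_coord k).continuous.measurable.comp measurable_snd
        · have h1 : Measurable fun a : E n × E n => (ε • a.2, a.1) := by fun_prop
          exact (stronglyMeasurable_segmentAverage (hDm k i)).measurable.comp h1
    · filter_upwards [ae_sub_translate_eq (hσi i) (hσ.weakDeriv i i).1 (fun k => hDm k i)
        (fun k => hσ.weakDeriv k i) (ε • z)] with x hx
      rw [hx, Finset.mul_sum]
      exact Finset.sum_congr rfl fun k _ => by simp [mul_assoc]
  filter_upwards [ae_all_iff.2 key] with x hx
  exact ae_all_iff.2 hx

theorem kernelRepresentation_T (hη : IsMollifierProfile η) (hfm : StronglyMeasurable f)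
    (hσm : StronglyMeasurable σ) (hDm : ∀ i j, StronglyMeasurable (D i j))
    (hp : 1 ≤ p) (hq : 1 ≤ q) (hr : 1 ≤ r) (hpqr : ENNReal.HolderTriple p q r)
    (hf : MemLpLoc f p) (hσ : MemW1Loc σ D q) :
    KernelRepresentation (weightT η) (fun ε => T η σ ε f) (fun x => -(divergence D x * f x)) r
      (fun K ε => eLpNorm f p (volume.restrict (Metric.cthickening ε K)) *
        eLpNorm (gradNorm D) q (volume.restrict (Metric.cthickening ε K)))
      (fun a h x => f (x - h) * segmentAverage (D a.2 a.1) h x)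
      (fun a x => f x * D a.2 a.1 x) := by
  have hP : ∀ a : Fin n × Fin n, StronglyMeasurable
      (Function.uncurry fun h x => f (x - h) * segmentAverage (D a.2 a.1) h x) := fun a =>
    (stronglyMeasurable_translate hfm).mul (stronglyMeasurable_segmentAverage (hDm a.2 a.1))
  have hB : ∀ K, IsCompact K → ∀ ε : ℝ,
      eLpNorm f p (volume.restrict (Metric.cthickening ε K)) *
        eLpNorm (gradNorm D) q (volume.restrict (Metric.cthickening ε K)) < ⊤ := fun K hK ε =>
    ENNReal.mul_lt_top (hf _ hK.cthickening).2
      (memLp_gradNorm fun i j => hσ.memLpLoc_deriv i j _ hK.cthickening).2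
  have hb : ∀ K, IsCompact K → ∀ ε : ℝ, ∀ (a : Fin n × Fin n) (h : E n), ‖h‖ ≤ ε →
      eLpNorm (fun x => f (x - h) * segmentAverage (D a.2 a.1) h x) r (volume.restrict K) ≤
      eLpNorm f p (volume.restrict (Metric.cthickening ε K)) *
        eLpNorm (gradNorm D) q (volume.restrict (Metric.cthickening ε K)) := fun K _ ε a h hh =>
    (eLpNorm_translate_mul_segmentAverage_le hfm (hDm _ _) hq hh).trans
      (mul_le_mul' le_rfl (eLpNorm_le_gradNorm D _ _ _ _))
  refine ⟨hP, fun a => hfm.mul (hDm _ _), hB, hb, fun K hK a => ?_, fun K hK ε hε => ?_, ?_⟩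
  · have : IsFiniteMeasure (volume.restrict K) := ⟨by simpa using hK.measure_lt_top⟩
    exact (hf.bddTendsto_translate hfm hK).mul hr
      ((hσ.memLpLoc_deriv _ _).bddTendsto_segmentAverage (hDm _ _) hq hK)
  · obtain ⟨W, hW⟩ := exists_norm_le (continuous_weightT hη) (support_weightT hη)
    have hint := ae_all_iff.2 fun a : Fin n × Fin n => ae_integrable_kernel
      (continuous_weightT hη a) (hW a) (hP a) hr (hB K hK ε).ne hε (hb K hK ε a)
    filter_upwards [ae_restrict_of_ae (ae_ae_sub_eq hσm hDm hσ ε), hint] with x hx hxi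
    rw [T_eq_sum_integral hη hε (hf.locallyIntegrable hp)
      fun i => (hf.mul (hσ.memLpLoc.coord i)).locallyIntegrable hr, Fintype.sum_prod_type]
    refine Finset.sum_congr rfl fun i _ => ?_
    simp only [kernelAverage]
    rw [← integral_finsetSum _ fun k _ => hxi (i, k)]
    refine integral_congr_ae ?_
    filter_upwards [hx] with z hz
    rw [hz i]
    -- The `ε` from the increment cancels the `ε⁻¹` from the kernel.
    calc _ = partialDeriv i η z * (f (x - ε • z) *
          ∑ k, z k * segmentAverage (D k i) (ε • z) x) := by field_simp
      _ = _ := by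
        simp only [Finset.mul_sum, weightT]
        exact Finset.sum_congr rfl fun k _ => by ring
  · refine ae_of_all _ fun x => ?_
    simp [setIntegral_weightT hη, Fintype.sum_prod_type, divergence, Finset.mul_sum, mul_comm]

/-- Hölder is applied twice: the two segment averages multiply into `L^s` with `1/s = 2/q`, and the
translate of `f` then brings the product into `L^r`. -/
theorem kernelRepresentation_S {s : ℝ≥0∞} (hη : IsMollifierProfile η)
    (hfm : StronglyMeasurable f)
    (hσm : StronglyMeasurable σ) (hDm : ∀ i j, StronglyMeasurable (D i j))
    (hp : 1 ≤ p) (hq : 1 ≤ q) (hr : 1 ≤ r) (hqs : ENNReal.HolderTriple q q s)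
    (hpsr : ENNReal.HolderTriple p s r) (hf : MemLpLoc f p) (hσ : MemW1Loc σ D q) :
    KernelRepresentation (weightS η) (fun ε => S η σ ε f)
      (fun x => (1 / 2) * ((∑ i, ∑ j, D i j x * D j i x) + divergence D x ^ 2) * f x) r
      (fun K ε => eLpNorm f p (volume.restrict (Metric.cthickening ε K)) *
        (eLpNorm (gradNorm D) q (volume.restrict (Metric.cthickening ε K)) *
          eLpNorm (gradNorm D) q (volume.restrict (Metric.cthickening ε K))))
      (fun a h x => f (x - h) *
        (segmentAverage (D a.2.1 a.1.1) h x * segmentAverage (D a.2.2 a.1.2) h x))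
      (fun a x => f x * (D a.2.1 a.1.1 x * D a.2.2 a.1.2 x)) := by
  have hrs : r ≤ s := ENNReal.HolderTriple.le s p r
  have hP : ∀ a : (Fin n × Fin n) × (Fin n × Fin n), StronglyMeasurable
      (Function.uncurry fun h x => f (x - h) *
        (segmentAverage (D a.2.1 a.1.1) h x * segmentAverage (D a.2.2 a.1.2) h x)) := fun a =>
    (stronglyMeasurable_translate hfm).mul ((stronglyMeasurable_segmentAverage (hDm _ _)).mul
      (stronglyMeasurable_segmentAverage (hDm _ _)))
  have hB : ∀ K, IsCompact K → ∀ ε : ℝ,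
      eLpNorm f p (volume.restrict (Metric.cthickening ε K)) *
        (eLpNorm (gradNorm D) q (volume.restrict (Metric.cthickening ε K)) *
          eLpNorm (gradNorm D) q (volume.restrict (Metric.cthickening ε K))) < ⊤ := fun K hK ε => by
    have hG := (memLp_gradNorm fun i j =>
      hσ.memLpLoc_deriv i j _ (hK.cthickening (r := ε))).2
    exact ENNReal.mul_lt_top (hf _ hK.cthickening).2 (ENNReal.mul_lt_top hG hG)
  have hb : ∀ K, IsCompact K → ∀ ε : ℝ, ∀ (a : (Fin n × Fin n) × (Fin n × Fin n)) (h : E n),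
      ‖h‖ ≤ ε → eLpNorm (fun x => f (x - h) *
        (segmentAverage (D a.2.1 a.1.1) h x * segmentAverage (D a.2.2 a.1.2) h x)) r
        (volume.restrict K) ≤
      eLpNorm f p (volume.restrict (Metric.cthickening ε K)) *
        (eLpNorm (gradNorm D) q (volume.restrict (Metric.cthickening ε K)) *
          eLpNorm (gradNorm D) q (volume.restrict (Metric.cthickening ε K))) := fun K _ ε a h hh =>
    (eLpNorm_translate_mul_segmentAverage_mul_le (s := s) hfm (hDm _ _) (hDm _ _) hq hh).trans
      (mul_le_mul' le_rfl (mul_le_mul' (eLpNorm_le_gradNorm D _ _ _ _)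
        (eLpNorm_le_gradNorm D _ _ _ _)))
  refine ⟨hP, fun a => hfm.mul ((hDm _ _).mul (hDm _ _)), hB, hb, fun K hK a => ?_,
    fun K hK ε hε => ?_, ?_⟩
  · have : IsFiniteMeasure (volume.restrict K) := ⟨by simpa using hK.measure_lt_top⟩
    exact (hf.bddTendsto_translate hfm hK).mul hr
      (((hσ.memLpLoc_deriv _ _).bddTendsto_segmentAverage (hDm _ _) hq hK).mul (hr.trans hrs)
        ((hσ.memLpLoc_deriv _ _).bddTendsto_segmentAverage (hDm _ _) hq hK))
  · obtain ⟨W, hW⟩ := exists_norm_le (continuous_weightS hη) (support_weightS hη)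
    have hint := ae_all_iff.2 fun a : (Fin n × Fin n) × (Fin n × Fin n) => ae_integrable_kernel
      (continuous_weightS hη a) (hW a) (hP a) hr (hB K hK ε).ne hε (hb K hK ε a)
    have hσσ : ∀ i j, LocallyIntegrable (fun y => f y * σ y i * σ y j) volume := fun i j => by
      simpa only [mul_assoc] using (hf.mul (r := r) (MemLpLoc.mul (r := s)
        (hσ.memLpLoc.coord i) (hσ.memLpLoc.coord j))).locallyIntegrable hr
    -- The product `f σᵢ` has exponent `(1/p + 1/q)⁻¹`, which is at least `r` because `s ≤ q`.
    have hfσ : ∀ i, LocallyIntegrable (fun y => f y * σ y i) volume := fun i => by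
      have : ENNReal.HolderTriple p q (p⁻¹ + q⁻¹)⁻¹ := .of p q
      refine (hf.mul (r := (p⁻¹ + q⁻¹)⁻¹) (hσ.memLpLoc.coord i)).locallyIntegrable (hr.trans ?_)
      have hsq : s ≤ q := ENNReal.HolderTriple.le q q s
      rw [← ENNReal.inv_le_inv, inv_inv, ← ENNReal.HolderTriple.inv_add_inv_eq_inv p s r]
      exact add_le_add le_rfl (ENNReal.inv_le_inv.2 hsq)
    filter_upwards [ae_restrict_of_ae (ae_ae_sub_eq hσm hDm hσ ε), hint] with x hx hxi
    rw [S_eq_sum_integral hη hε (hf.locallyIntegrable hp) hfσ hσσ, Fintype.sum_prod_type,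
      Finset.mul_sum, Fintype.sum_prod_type]
    refine Finset.sum_congr rfl fun i _ => ?_
    rw [Finset.mul_sum]
    refine Finset.sum_congr rfl fun j _ => ?_
    simp only [kernelAverage]
    rw [← integral_finsetSum _ fun k _ => hxi ((i, j), k), ← integral_const_mul]
    refine integral_congr_ae ?_
    filter_upwards [hx] with z hz
    rw [hz i, hz j]
    calc _ = (1 / 2) * partialDeriv i (partialDeriv j η) z * (f (x - ε • z) *
          ((∑ k, z k * segmentAverage (D k i) (ε • z) x) *
            ∑ l, z l * segmentAverage (D l j) (ε • z) x)) := by field_simp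
      _ = _ := by
        rw [Finset.sum_mul_sum, Fintype.sum_prod_type]
        simp only [Finset.mul_sum, weightS]
        exact Finset.sum_congr rfl fun k _ => Finset.sum_congr rfl fun l _ => by ring
  · refine ae_of_all _ fun x => ?_
    -- Of all `(k, l)`, the second moments keep only two pairings: `(i, j)`, which sums to the
    -- squared divergence, and `(j, i)`, which sums to `∂ᵢσⱼ ∂ⱼσᵢ`.
    have e : ∀ i j : Fin n, ∑ k, ∑ l, (1 / 2 : ℝ) * ((if k = i then 1 else 0) *
        (if l = j then 1 else 0) + (if l = i then 1 else 0) * (if k = j then 1 else 0)) *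
        (f x * (D k i x * D l j x)) =
        (1 / 2) * f x * (D i i x * D j j x + D i j x * D j i x) := by
      intro i j
      simp only [mul_add, add_mul, Finset.sum_add_distrib]
      simp [mul_ite, ite_mul]
      ring
    simp only [setIntegral_weightS hη, Fintype.sum_prod_type, e, ← Finset.mul_sum,
      Finset.sum_add_distrib, divergence, sq, Finset.sum_mul_sum]
    ring

end Representation

theorem KernelRepresentation.congr {A : Type*} [Fintype A] {w : A → E n → ℝ}
    {U U' : ℝ → E n → ℝ} {U₀ U₀' : E n → ℝ} {r : ℝ≥0∞} {B : Set (E n) → ℝ → ℝ≥0∞}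
    {P : A → E n → E n → ℝ} {P₀ : A → E n → ℝ} (H : KernelRepresentation w U U₀ r B P P₀)
    (hU : ∀ ε, U' ε =ᵐ[volume] U ε) (hU₀ : U₀' =ᵐ[volume] U₀) :
    KernelRepresentation w U' U₀' r B P P₀ :=
  { H with
    ae_eq := fun K hK ε hε => Filter.EventuallyEq.trans (ae_restrict_of_ae (hU ε)) (H.ae_eq K hK ε hε)
    ae_eq_lim := hU₀.trans H.ae_eq_lim }

/-! ### Independence of the choice of representatives -/

section Congr

variable {f f' : E n → ℝ} {σ σ' : E n → E n} {D D' : Fin n → Fin n → E n → ℝ} {p q : ℝ≥0∞}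

theorem MemLpLoc.congr {F : Type*} [NormedAddCommGroup F] {f f' : E n → F} (hf : MemLpLoc f p)
    (h : f' =ᵐ[volume] f) : MemLpLoc f' p := fun K hK =>
  (hf K hK).ae_eq (Filter.EventuallyEq.symm (ae_restrict_of_ae h))

theorem MemW1Loc.congr (H : MemW1Loc σ D q) (hσ : σ' =ᵐ[volume] σ)
    (hD : ∀ i j, D' i j =ᵐ[volume] D i j) : MemW1Loc σ' D' q where
  memLpLoc := H.memLpLoc.congr hσ
  weakDeriv i j := by
    obtain ⟨h1, h2, h3⟩ := H.weakDeriv i j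
    have hσj : (fun x => σ' x j) =ᵐ[volume] fun x => σ x j := by
      filter_upwards [hσ] with x hx
      rw [hx]
    refine ⟨memLpLoc_one_iff.1 ((memLpLoc_one_iff.2 h1).congr hσj),
      memLpLoc_one_iff.1 ((memLpLoc_one_iff.2 h2).congr (hD i j)), fun φ hφ hφc => ?_⟩
    calc _ = ∫ x, σ x j * partialDeriv i φ x := integral_congr_ae (hσj.mul .rfl)
      _ = -∫ x, D i j x * φ x := h3 φ hφ hφc
      _ = _ := congrArg Neg.neg (integral_congr_ae ((hD i j).symm.mul .rfl))
  memLpLoc_deriv i j := (H.memLpLoc_deriv i j).congr (hD i j)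

theorem mollify_congr (η : E n → ℝ) (ε : ℝ) (hf : f' =ᵐ[volume] f) :
    mollify η ε f' = mollify η ε f :=
  convolution_congr _ .rfl hf

theorem divDistribution_congr (hf : f' =ᵐ[volume] f) (hσ : σ' =ᵐ[volume] σ) :
    divDistribution σ' f' = divDistribution σ f := by
  ext φ
  rw [divDistribution, divDistribution]
  congr 1
  refine integral_congr_ae ?_
  filter_upwards [hf, hσ] with x h1 h2
  simp only [gradAlong, h1, h2]

theorem adjointDistribution_congr (hf : f' =ᵐ[volume] f) (hσ : σ' =ᵐ[volume] σ) :
    adjointDistribution σ' f' = adjointDistribution σ f := by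
  ext φ
  refine integral_congr_ae ?_
  filter_upwards [hf, hσ] with x h1 h2
  simp only [secondAlong, h1, h2]

/-- The mollified objects are integrals and agree everywhere; only the outer coefficient `σ(x)`
restricts the equality to almost every `x`. -/
theorem T_congr (η : E n → ℝ) (ε : ℝ) (hf : f' =ᵐ[volume] f) (hσ : σ' =ᵐ[volume] σ) :
    T η σ' ε f' =ᵐ[volume] T η σ ε f := by
  filter_upwards [hσ] with x hx
  simp only [T, mollify_congr η ε hf, divDistribution_congr hf hσ, gradAlong, hx]

theorem S_congr (η : E n → ℝ) (ε : ℝ) (hf : f' =ᵐ[volume] f) (hσ : σ' =ᵐ[volume] σ) :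
    S η σ' ε f' =ᵐ[volume] S η σ ε f := by
  filter_upwards [hσ] with x hx
  simp only [S, mollify_congr η ε hf, divDistribution_congr hf hσ,
    adjointDistribution_congr hf hσ, gradAlong, secondAlong, hx]

theorem gradNorm_congr (hD : ∀ i j, D' i j =ᵐ[volume] D i j) :
    gradNorm D' =ᵐ[volume] gradNorm D := by
  filter_upwards [ae_all_iff.2 fun i => ae_all_iff.2 (hD i)] with x hx
  simp only [gradNorm, hx]

theorem divergence_congr (hD : ∀ i j, D' i j =ᵐ[volume] D i j) :
    divergence D' =ᵐ[volume] divergence D := by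
  filter_upwards [ae_all_iff.2 fun i => ae_all_iff.2 (hD i)] with x hx
  simp only [divergence, hx]

/-- A locally integrable vector field with locally integrable weak derivatives, and a locally
integrable function, have strongly measurable representatives. -/
theorem exists_stronglyMeasurable_representatives (hp : 1 ≤ p) (hq : 1 ≤ q) (hf : MemLpLoc f p)
    (hσ : MemW1Loc σ D q) :
    ∃ (f' : E n → ℝ) (σ' : E n → E n) (D' : Fin n → Fin n → E n → ℝ),
      StronglyMeasurable f' ∧ StronglyMeasurable σ' ∧ (∀ i j, StronglyMeasurable (D' i j)) ∧
      f =ᵐ[volume] f' ∧ σ =ᵐ[volume] σ' ∧ (∀ i j, D i j =ᵐ[volume] D' i j) ∧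
      MemLpLoc f' p ∧ MemW1Loc σ' D' q := by
  have h1 := (hf.locallyIntegrable hp).aestronglyMeasurable
  have h2 := (hσ.memLpLoc.locallyIntegrable hq).aestronglyMeasurable
  have h3 := fun i j => ((hσ.memLpLoc_deriv i j).locallyIntegrable hq).aestronglyMeasurable
  exact ⟨h1.mk, h2.mk, fun i j => (h3 i j).mk, h1.stronglyMeasurable_mk, h2.stronglyMeasurable_mk,
    fun i j => (h3 i j).stronglyMeasurable_mk, h1.ae_eq_mk, h2.ae_eq_mk,
    fun i j => (h3 i j).ae_eq_mk, hf.congr h1.ae_eq_mk.symm,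
    hσ.congr h2.ae_eq_mk.symm fun i j => (h3 i j).ae_eq_mk.symm⟩

end Congr

/-! ### Kernel representations for arbitrary representatives -/

section Existence

variable {η : E n → ℝ} {f : E n → ℝ} {σ : E n → E n} {D : Fin n → Fin n → E n → ℝ}
  {p q r : ℝ≥0∞}

theorem exists_kernelRepresentation_T (hη : IsMollifierProfile η)
    (hp : 1 ≤ p) (hq : 1 ≤ q) (hr : 1 ≤ r) (hpqr : r⁻¹ = q⁻¹ + p⁻¹)
    (hf : MemLpLoc f p) (hσ : MemW1Loc σ D q) :
    ∃ P P₀, KernelRepresentation (weightT η) (fun ε => T η σ ε f)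
      (fun x => -(divergence D x * f x)) r
      (fun K ε => eLpNorm f p (volume.restrict (Metric.cthickening ε K)) *
        eLpNorm (gradNorm D) q (volume.restrict (Metric.cthickening ε K))) P P₀ := by
  obtain ⟨f', σ', D', hfm, hσm, hDm, ef, eσ, eD, hf', hσ'⟩ :=
    exists_stronglyMeasurable_representatives hp hq hf hσ
  have H := (kernelRepresentation_T hη hfm hσm hDm hp hq hr ⟨by rw [hpqr, add_comm]⟩ hf'
    hσ').congr (fun ε => T_congr η ε ef eσ) ((divergence_congr eD).mul ef).neg
  simp only [← eLpNorm_congr_ae (ae_restrict_of_ae ef),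
    ← eLpNorm_congr_ae (ae_restrict_of_ae (gradNorm_congr eD))] at H
  exact ⟨_, _, H⟩

theorem exists_kernelRepresentation_S (hη : IsMollifierProfile η)
    (hp : 1 ≤ p) (hq : 1 ≤ q) (hr : 1 ≤ r) (hpqr : r⁻¹ = 2 * q⁻¹ + p⁻¹)
    (hf : MemLpLoc f p) (hσ : MemW1Loc σ D q) :
    ∃ P P₀, KernelRepresentation (weightS η) (fun ε => S η σ ε f)
      (fun x => (1 / 2) * ((∑ i, ∑ j, D i j x * D j i x) + divergence D x ^ 2) * f x) r
      (fun K ε => eLpNorm f p (volume.restrict (Metric.cthickening ε K)) *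
        (eLpNorm (gradNorm D) q (volume.restrict (Metric.cthickening ε K)) *
          eLpNorm (gradNorm D) q (volume.restrict (Metric.cthickening ε K)))) P P₀ := by
  obtain ⟨f', σ', D', hfm, hσm, hDm, ef, eσ, eD, hf', hσ'⟩ :=
    exists_stronglyMeasurable_representatives hp hq hf hσ
  have hlim : (fun x => (1 / 2) * ((∑ i, ∑ j, D i j x * D j i x) + divergence D x ^ 2) * f x)
      =ᵐ[volume]
      fun x => (1 / 2) * ((∑ i, ∑ j, D' i j x * D' j i x) + divergence D' x ^ 2) * f' x := by
    filter_upwards [ef, divergence_congr eD, ae_all_iff.2 fun i => ae_all_iff.2 (eD i)]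
      with x h1 h2 h3
    simp only [h1, h2, h3]
  have H := (kernelRepresentation_S hη hfm hσm hDm hp hq hr (ENNReal.HolderTriple.of q q)
    ⟨by rw [inv_inv, hpqr, two_mul, add_comm]⟩ hf' hσ').congr
    (fun ε => S_congr η ε ef eσ) hlim
  simp only [← eLpNorm_congr_ae (ae_restrict_of_ae ef),
    ← eLpNorm_congr_ae (ae_restrict_of_ae (gradNorm_congr eD))] at H
  exact ⟨_, _, H⟩

end Existence

end Commutator

theorem mainTheorem8 {n : ℕ} (η : Commutator.E n → ℝ) (hη : Commutator.IsMollifierProfile η) :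
    (∀ p q r : ℝ≥0∞, 1 ≤ p → 1 ≤ q → 1 ≤ r → r ≠ ⊤ → r⁻¹ = q⁻¹ + p⁻¹ →
      ∀ (f : Commutator.E n → ℝ) (σ : Commutator.E n → Commutator.E n)
        (D : Fin n → Fin n → Commutator.E n → ℝ),
        Commutator.MemLpLoc f p → Commutator.MemW1Loc σ D q →
        Commutator.TendstoLpLoc (fun ε => Commutator.T η σ ε f)
          (fun x => -(Commutator.divergence D x * f x)) r) ∧
    (∀ p q r : ℝ≥0∞, 1 ≤ p → 1 ≤ q → 1 ≤ r → r ≠ ⊤ → r⁻¹ = 2 * q⁻¹ + p⁻¹ →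
      ∀ (f : Commutator.E n → ℝ) (σ : Commutator.E n → Commutator.E n)
        (D : Fin n → Fin n → Commutator.E n → ℝ),
        Commutator.MemLpLoc f p → Commutator.MemW1Loc σ D q →
        Commutator.TendstoLpLoc (fun ε => Commutator.S η σ ε f)
          (fun x => (1 / 2) * ((∑ i, ∑ j, D i j x * D j i x) + Commutator.divergence D x ^ 2) * f x)
          r) ∧
    ∃ C : ℝ≥0,
      (∀ p q r : ℝ≥0∞, 1 ≤ p → 1 ≤ q → 1 ≤ r → r⁻¹ = q⁻¹ + p⁻¹ →
        ∀ (f : Commutator.E n → ℝ) (σ : Commutator.E n → Commutator.E n)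
          (D : Fin n → Fin n → Commutator.E n → ℝ),
          Commutator.MemLpLoc f p → Commutator.MemW1Loc σ D q →
          ∀ (K : Set (Commutator.E n)), IsCompact K → ∀ ε : ℝ, 0 < ε →
            MemLp (Commutator.T η σ ε f) r (volume.restrict K) ∧
            eLpNorm (Commutator.T η σ ε f) r (volume.restrict K) ≤
              C * eLpNorm (Commutator.gradNorm D) q (volume.restrict (Metric.cthickening ε K)) *
                eLpNorm f p (volume.restrict (Metric.cthickening ε K))) ∧
      (∀ p q r : ℝ≥0∞, 1 ≤ p → 1 ≤ q → 1 ≤ r → r⁻¹ = 2 * q⁻¹ + p⁻¹ →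
        ∀ (f : Commutator.E n → ℝ) (σ : Commutator.E n → Commutator.E n)
          (D : Fin n → Fin n → Commutator.E n → ℝ),
          Commutator.MemLpLoc f p → Commutator.MemW1Loc σ D q →
          ∀ (K : Set (Commutator.E n)), IsCompact K → ∀ ε : ℝ, 0 < ε →
            MemLp (Commutator.S η σ ε f) r (volume.restrict K) ∧
            eLpNorm (Commutator.S η σ ε f) r (volume.restrict K) ≤
              C * eLpNorm (Commutator.gradNorm D) q (volume.restrict (Metric.cthickening ε K)) ^ 2 *
                eLpNorm f p (volume.restrict (Metric.cthickening ε K))) := by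
  obtain ⟨W, hW⟩ := Commutator.exists_norm_le (Commutator.continuous_weightT hη)
    (Commutator.support_weightT hη)
  obtain ⟨W', hW'⟩ := Commutator.exists_norm_le (Commutator.continuous_weightS hη)
    (Commutator.support_weightS hη)
  have hV : volume (Metric.closedBall (0 : Commutator.E n) 1) ≠ ⊤ := measure_closedBall_lt_top.ne
  -- The constant is the volume of the unit ball times the sum of the uniform bounds for all
  -- weights. Both families are included so that one constant, fixed by `η` alone, serves `T` and
  -- `S`.
  refine ⟨?_, ?_, (volume (Metric.closedBall (0 : Commutator.E n) 1)).toNNReal *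
    ((∑ a, W a) + ∑ a, W' a), ?_, ?_⟩
  · intro p q r hp hq hr hr' hpqr f σ D hf hσ
    obtain ⟨P, P₀, H⟩ := Commutator.exists_kernelRepresentation_T hη hp hq hr hpqr hf hσ
    exact H.tendstoLpLoc (Commutator.continuous_weightT hη) hW hr hr'
  · intro p q r hp hq hr hr' hpqr f σ D hf hσ
    obtain ⟨P, P₀, H⟩ := Commutator.exists_kernelRepresentation_S hη hp hq hr hpqr hf hσ
    exact H.tendstoLpLoc (Commutator.continuous_weightS hη) hW' hr hr'
  · intro p q r hp hq hr hpqr f σ D hf hσ K hK ε hε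
    obtain ⟨P, P₀, H⟩ := Commutator.exists_kernelRepresentation_T hη hp hq hr hpqr hf hσ
    refine ⟨H.memLp (Commutator.continuous_weightT hη) hW hr hK hε,
      (H.eLpNorm_le (Commutator.continuous_weightT hη) hW hr hK hε).trans ?_⟩
    rw [mul_comm (eLpNorm f p _), ← mul_assoc, ENNReal.coe_mul, ENNReal.coe_toNNReal hV]
    exact mul_le_mul' (mul_le_mul' (mul_le_mul' le_rfl (ENNReal.coe_le_coe.2 le_self_add)) le_rfl) le_rfl
  · intro p q r hp hq hr hpqr f σ D hf hσ K hK ε hε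
    obtain ⟨P, P₀, H⟩ := Commutator.exists_kernelRepresentation_S hη hp hq hr hpqr hf hσ
    refine ⟨H.memLp (Commutator.continuous_weightS hη) hW' hr hK hε,
      (H.eLpNorm_le (Commutator.continuous_weightS hη) hW' hr hK hε).trans ?_⟩
    rw [mul_comm (eLpNorm f p _), ← mul_assoc, ENNReal.coe_mul, ENNReal.coe_toNNReal hV, sq]
    exact mul_le_mul' (mul_le_mul' (mul_le_mul' le_rfl (ENNReal.coe_le_coe.2 le_add_self)) le_rfl) le_rfl
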